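/- Let $\mathrm{Sym}(3)$ be the space of symmetric real $3\times3$ matrices with $\langle X,Y\rangle=\operatorname{tr}(XY^T)$, $\mathrm{Sym}^{++}(3)$ its positive definite elements, $\mathrm{GL}^+(3)=\{F\in\mathbb R^{3\times 3}:\det F>0\}$, and for $F\in\mathrm{GL}^+(3)$ let $J=\det F$ and $V=\sqrt{FF^T}$. An \emph{isotropic Cauchy-elastic law} is a differentiable map $F\mapsto\sigma(F)\in\mathrm{Sym}(3)$ on $\mathrm{GL}^+(3)$ (the Cauchy stress) with $\sigma(QF)=Q\sigma(F)Q^T$ and $\sigma(FQ)=\sigma(F)$ for all $Q\in\mathrm{SO}(3)$. An \emph{isotropic hyperelastic law} is $\sigma(F)=\frac1J\,\mathrm D_FW(F)\,F^T$, where $W:\mathrm{GL}^+(3)\to\mathbb R$ is twice differentiable and $W(Q_1^TFQ_2)=W(F)$ for all $Q_1,Q_2\in\mathrm{SO}(3)$. The Kirchhoff stress is $\tau=J\sigma$, and $\widehat\tau$ is the function on $\mathrm{Sym}(3)$ given by $\widehat\tau(X)=\tau(\exp X)$; $\mathrm D_{\log V}\widehat\tau$ is its Fréchet derivative on $\mathrm{Sym}(3)$.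 For a differentiable curve $t\mapsto F(t)\in\mathrm{GL}^+(3)$ put $L=\dot FF^{-1}$, $D=\operatorname{sym}L$, $\mathcal W=\operatorname{skew}L$, and let $$\frac{\mathrm D^{\mathrm{ZJ}}}{\mathrm Dt}[\tau]=\frac{\mathrm d}{\mathrm dt}\tau(F(t))+\tau\,\mathcal W-\mathcal W\,\tau$$ be the Zaremba--Jaumann rate. We say that Hill's rate condition (H) holds at $F_0\in\mathrm{GL}^+(3)$ if $\big\langle \frac{\mathrm D^{\mathrm{ZJ}}}{\mathrm Dt}[\tau],D\big\rangle>0$ at time $t$ for every such curve and every $t$ with $F(t)=F_0$ and $D(t)\neq0$. Let $\mathrm{Sym}_4^{++}(6)$ be the set of linear maps $\mathbb C$ on $\mathrm{Sym}(3)$ that are self-adjoint and satisfy $\langle\mathbb C.H,H\rangle>0$ for all $H\in\mathrm{Sym}(3)\setminus\{0\}$, and let $\operatorname{sym}\mathbb C=\frac12(\mathbb C+\mathbb C^T)$. \textbf{Cauchy-elastic case.} For every isotropic Cauchy-elastic law, $\widehat\tau$ is differentiable, $\tau(F)=\widehat\tau(\log V)$ for all $F\in\mathrm{GL}^+(3)$,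 and: (1) for every $F\in\mathrm{GL}^+(3)$, (H) holds at $F$ if and only if $\operatorname{sym}\mathrm D_{\log V}\widehat\tau(\log V)\in\mathrm{Sym}_4^{++}(6)$, where $V=\sqrt{FF^T}$; (2) consequently, (H) holds at every $F\in\mathrm{GL}^+(3)$ if and only if $\operatorname{sym}\mathrm D_{\log V}\widehat\tau(\log V)\in\mathrm{Sym}_4^{++}(6)$ for every $V\in\mathrm{Sym}^{++}(3)$; (3) if $\operatorname{sym}\mathrm D_{\log V}\widehat\tau(\log V)\in\mathrm{Sym}_4^{++}(6)$ for every $V\in\mathrm{Sym}^{++}(3)$, then $\widehat\tau$ is strictly monotone in $\log V$ (Hill's inequality): $$\langle\widehat\tau(\log V_1)-\widehat\tau(\log V_2),\log V_1-\log V_2\rangle>0\qquad\text{for all }V_1\neq V_2\in\mathrm{Sym}^{++}(3).$$ \textbf{Hyperelastic case.} Every isotropic hyperelastic law is an isotropic Cauchy-elastic law; moreover $\mathrm D_{\log V}\widehat\tau$ is self-adjoint at every point of $\mathrm{Sym}(3)$, i.e. $\operatorname{sym}\mathrm D_{\log V}\widehat\tau=\mathrm D_{\log V}\widehat\tau$,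 and (1)--(3) hold with $\mathrm D_{\log V}\widehat\tau(\log V)$ itself in place of its symmetric part. -/

import Mathlib

open scoped Matrix

noncomputable section

namespace HillInequality

/-- Real `3 × 3` matrices (second order tensors), with the entrywise topology. -/
abbrev Mat : Type := Matrix (Fin 3) (Fin 3) ℝ

/-- `Sym(3)`, the space of symmetric second order tensors. -/
def Sym3 : Submodule ℝ Mat where
  carrier := {X | X.IsSymm}
  add_mem' := fun hX hY => hX.add hY
  zero_mem' := Matrix.isSymm_zero
  smul_mem' := fun c _ hX => hX.smul c

/-- `GL⁺(3)`. -/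
def GLpos : Set Mat := {F | 0 < F.det}

/-- `SO(3)`. -/
def SO3 : Set Mat := {Q | Qᵀ * Q = 1 ∧ Q.det = 1}

/-- The Frobenius scalar product `⟨X, Y⟩ = tr (X Yᵀ)`. -/
def frob (X Y : Mat) : ℝ := (X * Yᵀ).trace

/-- `sym X = (X + Xᵀ) / 2`. -/
def sym (X : Mat) : Mat := (1 / 2 : ℝ) • (X + Xᵀ)

/-- `skew X = (X - Xᵀ) / 2`. -/
def skew (X : Mat) : Mat := (1 / 2 : ℝ) • (X - Xᵀ)

/-! ### Stretch and logarithmic strain -/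

/-- The left stretch tensor `V = √(F Fᵀ)`. -/
def leftStretch (F : Mat) : Mat := cfc Real.sqrt (F * Fᵀ)

/-- The (principal) matrix logarithm `log V` of a positive definite symmetric `V`, as an element
of `Sym(3)`. -/
def logSym (V : Mat) : Sym3 := ⟨cfc Real.log V, by
  have h : IsSelfAdjoint (cfc Real.log V) := cfc_predicate Real.log V
  have h' : (cfc Real.log V)ᴴ = cfc Real.log V := h
  rwa [Matrix.conjTranspose_eq_transpose_of_trivial] at h'⟩

/-! ### Elastic laws -/

/-- An isotropic Cauchy-elastic law for the Cauchy stress `F ↦ σ(F)`, `F ∈ GL⁺(3)`: the stress is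
symmetric, frame-indifferent, isotropic, and depends differentiably on `F`. -/
structure IsIsotropicCauchyElastic (σ : Mat → Mat) : Prop where
  symm : ∀ F ∈ GLpos, (σ F).IsSymm
  objective : ∀ F ∈ GLpos, ∀ Q ∈ SO3, σ (Q * F) = Q * σ F * Qᵀ
  isotropic : ∀ F ∈ GLpos, ∀ Q ∈ SO3, σ (F * Q) = σ F
  differentiable : DifferentiableOn ℝ σ GLpos

/-- First Piola–Kirchhoff stress `S₁ = D_F W(F)`, the Frobenius gradient of the energy `W`. -/
def firstPiola (W : Mat → ℝ) (F : Mat) : Mat :=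
  Matrix.of fun i j => fderiv ℝ W F (Matrix.single i j 1)

/-- A frame-indifferent, isotropic, twice differentiable stored energy on `GL⁺(3)`. -/
structure IsIsotropicEnergy (W : Mat → ℝ) : Prop where
  invariant : ∀ F ∈ GLpos, ∀ Q₁ ∈ SO3, ∀ Q₂ ∈ SO3, W (Q₁ᵀ * F * Q₂) = W F
  differentiable : DifferentiableOn ℝ W GLpos
  differentiable_gradient : DifferentiableOn ℝ (firstPiola W) GLpos

/-- The Cauchy stress `σ = J⁻¹ S₁ Fᵀ` of a hyperelastic material with energy `W`. -/
def cauchyStress (W : Mat → ℝ) (F : Mat) : Mat := F.det⁻¹ • (firstPiola W F * Fᵀ)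

/-- The Kirchhoff stress `τ = J σ`, `J = det F`. -/
def kirchhoff (σ : Mat → Mat) (F : Mat) : Mat := F.det • σ F

/-- The Kirchhoff stress as a function of the logarithmic strain:
`τ̂(X)` is the Kirchhoff stress in the state `F = V = exp X`. -/
def hatTau (σ : Mat → Mat) (X : Sym3) : Mat := kirchhoff σ (NormedSpace.exp (X : Mat))

/-! ### Zaremba–Jaumann rate and the corotational condition -/

/-- The velocity gradient `L = Ḟ F⁻¹` of a deformation gradient history `F` at time `t`. -/
def velGrad (F : ℝ → Mat) (t : ℝ) : Mat := deriv F t * (F t)⁻¹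

/-- The strain rate `D = sym L`. -/
def strainRate (F : ℝ → Mat) (t : ℝ) : Mat := sym (velGrad F t)

/-- The vorticity `W = skew L`. -/
def vorticity (F : ℝ → Mat) (t : ℝ) : Mat := skew (velGrad F t)

/-- The Zaremba–Jaumann rate `d/dt τ + τ W - W τ` of `τ(F(t))` along the history `F`. -/
def zjRate (τ : Mat → Mat) (F : ℝ → Mat) (t : ℝ) : Mat :=
  deriv (fun s => τ (F s)) t + τ (F t) * vorticity F t - vorticity F t * τ (F t)

/-- `⟨D^ZJ/Dt [τ], D⟩ > 0` for all `D ≠ 0` in the state `F₀`: for every history of deformation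
gradients in `GL⁺(3)` that passes through `F₀` with nonzero strain rate `D`. -/
def CorotationalAt (τ : Mat → Mat) (F₀ : Mat) : Prop :=
  ∀ (F : ℝ → Mat) (t : ℝ), Differentiable ℝ F → (∀ s, F s ∈ GLpos) → F t = F₀ →
    strainRate F t ≠ 0 → 0 < frob (zjRate τ F t) (strainRate F t)

/-! ### Fourth order tensors -/

/-- A linear map `T` from `Sym(3)` to tensors as a bilinear form `(H, K) ↦ ⟨T.H, K⟩` on `Sym(3)`. -/
def tensorForm (T : Sym3 →L[ℝ] Mat) : LinearMap.BilinForm ℝ Sym3 :=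
  LinearMap.mk₂ ℝ (fun H K => frob (T H) (K : Mat))
    (fun H₁ H₂ K => by simp [frob, Matrix.add_mul])
    (fun c H K => by simp [frob])
    (fun H K₁ K₂ => by simp [frob, Matrix.mul_add])
    (fun c H K => by simp [frob])

/-- The fourth order tensor `D_{log V} τ̂` at `X = log V`: `(H, K) ↦ ⟨D τ̂(X).H, K⟩`, with the
Fréchet derivative of `τ̂` on `Sym(3)`. -/
def tangent (σ : Mat → Mat) (X : Sym3) : LinearMap.BilinForm ℝ Sym3 :=
  tensorForm (fderiv ℝ (hatTau σ) X)

/-- The (major) symmetric part of a fourth order tensor. -/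
def symPart (B : LinearMap.BilinForm ℝ Sym3) : LinearMap.BilinForm ℝ Sym3 :=
  (1 / 2 : ℝ) • (B + LinearMap.flip B)

/-- `Sym₄⁺⁺(6)`: (major) symmetric and positive definite on `Sym(3)`. -/
def IsSymPosDef4 (B : LinearMap.BilinForm ℝ Sym3) : Prop :=
  (∀ H K, B H K = B K H) ∧ ∀ H, H ≠ 0 → 0 < B H H

/-- Strict Hilbert monotonicity of `τ̂` in `log V`. -/
def StrictlyMonotoneInLog (σ : Mat → Mat) : Prop :=
  ∀ V₁ V₂ : Mat, V₁.PosDef → V₂.PosDef → V₁ ≠ V₂ →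
    0 < frob (hatTau σ (logSym V₁) - hatTau σ (logSym V₂)) (logSym V₁ - logSym V₂ : Mat)

end HillInequality

end

open HillInequality

namespace HillInequality

section Calculus

/-! ### The Frobenius scalar product -/

/-! Write `τ` for the Kirchhoff stress. Differentiating objectivity along rotations gives Dτ(F)[ΩF]
= Ωτ - τΩ for skew Ω, which is exactly what the corotational terms remove. The Zaremba–Jaumann rate
is therefore Dτ(F)[DF], and Hill's condition at F says that D ↦ ⟨Dτ(F)[DF], D⟩ is positive definite
on Sym(3) (`corotationalAt_iff`). Right isotropy and the polar decomposition reduce F to V = exp X.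

On the other side the chain rule gives Dτ̂(X)[H] = Dτ(V)[Dexp(X)[H]]. In an eigenbasis, X = diag x,
and the Daleckii–Krein formula splits Dexp(X)[H] as (w ⊙ H)V + VΩ, with Ω skew and w a symmetric,
positive weight with unit diagonal (`fderiv_exp_diagonal_eq_add`). Isotropy kills VΩ, so Dτ̂(X)[H] =
L(w ⊙ H) where L(D) = Dτ(V)[DV].

The two quadratic forms are thus ⟨L D, D⟩ and ⟨L(w ⊙ H), H⟩. Since V is fixed by the axis
reflections, L commutes with them; hence L preserves the diagonal matrices and each span of E_ij and
E_ji, and it commutes with entrywise multiplication by s = √w (`map_hadamard_of_reflection`). So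
⟨L(w ⊙ H), H⟩ = ⟨L(s ⊙ H), s ⊙ H⟩, and H ↦ s ⊙ H is a bijection of Sym(3): the forms are congruent
and positive definite together.

Hill's inequality follows because the stress component in the direction of a segment in log-strain
space has positive derivative along it. In the hyperelastic case τ̂ is the gradient of X ↦ W(exp X)
(`fderiv_energy_exp`), so its derivative is self-adjoint by symmetry of second derivatives. -/

theorem frob_eq_sum (X Y : Mat) : frob X Y = ∑ i, ∑ j, X i j * Y i j := by
  simp [frob, Matrix.trace, Matrix.mul_apply]

theorem frob_conj {Q : Mat} (hQ : Qᵀ * Q = 1) (X Y : Mat) :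
    frob (Q * X * Qᵀ) (Q * Y * Qᵀ) = frob X Y := by
  have h : Q * X * Qᵀ * (Q * Y * Qᵀ)ᵀ = Q * (X * (Qᵀ * Q) * Yᵀ) * Qᵀ := by
    simp only [Matrix.transpose_mul, Matrix.transpose_transpose, Matrix.mul_assoc]
  rw [frob, h, hQ, Matrix.mul_one, Matrix.trace_mul_comm, ← Matrix.mul_assoc, hQ, Matrix.one_mul,
    frob]

theorem frob_hadamard (s X Y : Mat) : frob (s ⊙ X) Y = frob X (s ⊙ Y) := by
  simp only [frob_eq_sum, Matrix.hadamard_apply]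
  exact Finset.sum_congr rfl fun i _ => Finset.sum_congr rfl fun j _ => by ring

/-! ### The matrix exponential -/

theorem differentiable_exp : Differentiable ℝ (NormedSpace.exp : Mat → Mat) := by
  -- Differentiability depends only on the topology, so any submultiplicative norm inducing the
  -- entrywise topology may be used locally.
  let : NormedRing Mat := Matrix.linftyOpNormedRing
  let : NormedAlgebra ℝ Mat := Matrix.linftyOpNormedAlgebra
  exact fun X => (NormedSpace.exp_analytic (𝕂 := ℝ) X).differentiableAt

theorem hasDerivAt_exp_smul (X : Mat) :
    HasDerivAt (fun s : ℝ => NormedSpace.exp (s • X)) X 0 := by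
  let : NormedRing Mat := Matrix.linftyOpNormedRing
  let : NormedAlgebra ℝ Mat := Matrix.linftyOpNormedAlgebra
  have h := hasDerivAt_exp_smul_const X (0 : ℝ)
  rw [zero_smul, NormedSpace.exp_zero, one_mul] at h
  exact h

theorem exp_mul_exp_neg (X : Mat) : NormedSpace.exp X * NormedSpace.exp (-X) = 1 := by
  rw [← Matrix.exp_add_of_commute _ _ (Commute.neg_right (Commute.refl X)), add_neg_cancel,
    NormedSpace.exp_zero]

theorem exp_half_mul_self (X : Mat) :
    NormedSpace.exp ((1 / 2 : ℝ) • X) * NormedSpace.exp ((1 / 2 : ℝ) • X) = NormedSpace.exp X := by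
  rw [← Matrix.exp_add_of_commute _ _ (Commute.refl _), ← add_smul]
  norm_num

/-- The determinant is a nonzero square, because exp X is the square of the invertible matrix
exp(X/2). -/
theorem exp_mem_GLpos (X : Mat) : NormedSpace.exp X ∈ GLpos := by
  have h : IsUnit (NormedSpace.exp ((1 / 2 : ℝ) • X)).det :=
    (Matrix.isUnit_iff_isUnit_det _).mp (Matrix.isUnit_exp _)
  change 0 < (NormedSpace.exp X).det
  rw [← exp_half_mul_self, Matrix.det_mul]
  exact mul_self_pos.mpr h.ne_zero

theorem mul_mem_GLpos {F G : Mat} (hF : F ∈ GLpos) (hG : G ∈ GLpos) : F * G ∈ GLpos := by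
  change 0 < (F * G).det
  rw [Matrix.det_mul]
  exact mul_pos hF hG

theorem mem_SO3_of_mem_GLpos {Q : Mat} (hQ : Qᵀ * Q = 1) (hdet : Q ∈ GLpos) : Q ∈ SO3 := by
  refine ⟨hQ, ?_⟩
  have h := congrArg Matrix.det hQ
  rw [Matrix.det_mul, Matrix.det_transpose, Matrix.det_one] at h
  have hpos : 0 < Q.det := hdet
  nlinarith

theorem mem_GLpos_of_mem_SO3 {Q : Mat} (hQ : Q ∈ SO3) : Q ∈ GLpos := by
  change 0 < Q.det
  rw [hQ.2]
  exact one_pos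

theorem mul_transpose_of_transpose_mul {Q : Mat} (hQ : Qᵀ * Q = 1) : Q * Qᵀ = 1 :=
  mul_eq_one_comm.mp hQ

theorem exp_mem_SO3 {Ω : Mat} (hΩ : Ωᵀ = -Ω) : NormedSpace.exp Ω ∈ SO3 := by
  refine mem_SO3_of_mem_GLpos ?_ (exp_mem_GLpos Ω)
  rw [← Matrix.exp_transpose, hΩ]
  exact mul_eq_one_comm.mp (exp_mul_exp_neg Ω)

theorem exp_conj_orthogonal {Q : Mat} (hQ : Qᵀ * Q = 1) (X : Mat) :
    NormedSpace.exp (Q * X * Qᵀ) = Q * NormedSpace.exp X * Qᵀ := by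
  have hinv : Q⁻¹ = Qᵀ := Matrix.inv_eq_left_inv hQ
  rw [← hinv]
  exact Matrix.exp_conj Q X (IsUnit.of_mul_eq_one _ (mul_transpose_of_transpose_mul hQ))

theorem isOpen_GLpos : IsOpen GLpos :=
  isOpen_lt continuous_const (continuous_id.matrix_det)

/-! ### Derivatives along curves and under two-sided multiplication -/

theorem hasDerivAt_comp_curve {f : Mat → Mat} {c : ℝ → Mat} {t : ℝ} {c' : Mat}
    (hf : DifferentiableAt ℝ f (c t)) (hc : HasDerivAt c c' t) :
    HasDerivAt (fun s => f (c s)) (fderiv ℝ f (c t) c') t := by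
  let : NormedRing Mat := Matrix.linftyOpNormedRing
  let : NormedAlgebra ℝ Mat := Matrix.linftyOpNormedAlgebra
  exact hf.hasFDerivAt.comp_hasDerivAt t hc

theorem hasDerivAt_comp_curve_real {f : Mat → ℝ} {c : ℝ → Mat} {t : ℝ} {c' : Mat}
    (hf : DifferentiableAt ℝ f (c t)) (hc : HasDerivAt c c' t) :
    HasDerivAt (fun s => f (c s)) (fderiv ℝ f (c t) c') t := by
  let : NormedRing Mat := Matrix.linftyOpNormedRing
  let : NormedAlgebra ℝ Mat := Matrix.linftyOpNormedAlgebra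
  exact hf.hasFDerivAt.comp_hasDerivAt t hc

theorem hasDerivAt_eq_of_eventuallyEq {c d : ℝ → Mat} {t : ℝ} {c' d' : Mat}
    (hc : HasDerivAt c c' t) (hd : HasDerivAt d d' t) (h : ∀ᶠ s in nhds t, c s = d s) :
    c' = d' := by
  let : NormedRing Mat := Matrix.linftyOpNormedRing
  let : NormedAlgebra ℝ Mat := Matrix.linftyOpNormedAlgebra
  exact HasDerivAt.unique hc (HasDerivAt.congr_of_eventuallyEq hd h)

theorem deriv_eq_of_hasDerivAt {c : ℝ → Mat} {t : ℝ} {c' : Mat} (hc : HasDerivAt c c' t) :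
    deriv c t = c' := by
  let : NormedRing Mat := Matrix.linftyOpNormedRing
  let : NormedAlgebra ℝ Mat := Matrix.linftyOpNormedAlgebra
  exact HasDerivAt.deriv hc

theorem hasDerivAt_deriv {c : ℝ → Mat} {t : ℝ} (hc : DifferentiableAt ℝ c t) :
    HasDerivAt c (deriv c t) t := by
  let : NormedRing Mat := Matrix.linftyOpNormedRing
  let : NormedAlgebra ℝ Mat := Matrix.linftyOpNormedAlgebra
  exact DifferentiableAt.hasDerivAt hc

theorem hasDerivAt_const_curve (F : Mat) (t : ℝ) : HasDerivAt (fun _ => F) 0 t := by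
  let : NormedRing Mat := Matrix.linftyOpNormedRing
  let : NormedAlgebra ℝ Mat := Matrix.linftyOpNormedAlgebra
  exact hasDerivAt_const t F

theorem hasDerivAt_mul {c d : ℝ → Mat} {t : ℝ} {c' d' : Mat} (hc : HasDerivAt c c' t)
    (hd : HasDerivAt d d' t) : HasDerivAt (fun s => c s * d s) (c' * d t + c t * d') t := by
  let : NormedRing Mat := Matrix.linftyOpNormedRing
  let : NormedAlgebra ℝ Mat := Matrix.linftyOpNormedAlgebra
  exact HasDerivAt.mul hc hd

theorem hasDerivAt_mul_mul {c : ℝ → Mat} {t : ℝ} {c' : Mat} (P Q : Mat)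
    (hc : HasDerivAt c c' t) : HasDerivAt (fun s => P * c s * Q) (P * c' * Q) t := by
  let : NormedRing Mat := Matrix.linftyOpNormedRing
  let : NormedAlgebra ℝ Mat := Matrix.linftyOpNormedAlgebra
  exact (HasDerivAt.const_mul P hc).mul_const Q

theorem hasDerivAt_line (F H : Mat) : HasDerivAt (fun s : ℝ => F + s • H) H 0 := by
  let : NormedRing Mat := Matrix.linftyOpNormedRing
  let : NormedAlgebra ℝ Mat := Matrix.linftyOpNormedAlgebra
  have h := ((hasDerivAt_id (0 : ℝ)).smul_const H).const_add F
  rw [one_smul] at h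
  exact h

/-- If `f (P F Q) = M (f F) N` on an open set, the derivative satisfies the same rule. -/
theorem fderiv_mul_mul {f : Mat → Mat} {S : Set Mat} (hS : IsOpen S) (hf : DifferentiableOn ℝ f S)
    {P Q M N : Mat} (hmem : ∀ F ∈ S, P * F * Q ∈ S) (heq : ∀ F ∈ S, f (P * F * Q) = M * f F * N)
    {F : Mat} (hF : F ∈ S) (H : Mat) :
    fderiv ℝ f (P * F * Q) (P * H * Q) = M * fderiv ℝ f F H * N := by
  have hline := hasDerivAt_line F H
  have hF0 : F + (0 : ℝ) • H = F := by simp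
  have h1 : HasDerivAt (fun s : ℝ => M * f (F + s • H) * N) (M * fderiv ℝ f F H * N) 0 := by
    have := hasDerivAt_comp_curve (f := f) (t := 0) (c := fun s : ℝ => F + s • H)
      (by simpa only [hF0] using hf.differentiableAt (hS.mem_nhds hF)) hline
    simp only [hF0] at this
    exact hasDerivAt_mul_mul M N this
  have h2 : HasDerivAt (fun s : ℝ => f (P * (F + s • H) * Q))
      (fderiv ℝ f (P * F * Q) (P * H * Q)) 0 := by
    have := hasDerivAt_comp_curve (f := f) (t := 0) (c := fun s : ℝ => P * (F + s • H) * Q)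
      (by simpa only [hF0] using hf.differentiableAt (hS.mem_nhds (hmem F hF)))
      (hasDerivAt_mul_mul P Q hline)
    simpa only [hF0] using this
  refine hasDerivAt_eq_of_eventuallyEq h2 h1 ?_
  have hmemS : ∀ᶠ s in nhds (0 : ℝ), F + s • H ∈ S :=
    (by fun_prop : Continuous fun s : ℝ => F + s • H).continuousAt.eventually_mem
      (by simpa only [hF0] using hS.mem_nhds hF)
  filter_upwards [hmemS] with s hs using heq _ hs

/-! ### The derivative of the matrix exponential -/

theorem fderiv_exp_conj {Q : Mat} (hQ : Qᵀ * Q = 1) (X H : Mat) :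
    fderiv ℝ (NormedSpace.exp : Mat → Mat) (Q * X * Qᵀ) (Q * H * Qᵀ)
      = Q * fderiv ℝ (NormedSpace.exp : Mat → Mat) X H * Qᵀ :=
  fderiv_mul_mul isOpen_univ differentiable_exp.differentiableOn (fun _ _ => Set.mem_univ _)
    (fun F _ => exp_conj_orthogonal hQ F) (Set.mem_univ X) H

theorem fderiv_exp_of_commute {X H : Mat} (h : Commute X H) :
    fderiv ℝ (NormedSpace.exp : Mat → Mat) X H = NormedSpace.exp X * H := by
  have h1 := hasDerivAt_comp_curve (t := 0) (differentiable_exp _) (hasDerivAt_line X H)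
  have h2 : HasDerivAt (fun s : ℝ => NormedSpace.exp (X + s • H)) (NormedSpace.exp X * H) 0 := by
    have := hasDerivAt_mul_mul (NormedSpace.exp X) 1 (hasDerivAt_exp_smul H)
    simp only [Matrix.mul_one] at this
    refine (funext fun s => ?_ : (fun s : ℝ => NormedSpace.exp (X + s • H)) = _) ▸ this
    exact Matrix.exp_add_of_commute _ _ (h.smul_right s)
  have h3 := hasDerivAt_eq_of_eventuallyEq h1 h2 (Filter.Eventually.of_forall fun _ => rfl)
  simpa using h3

theorem hasDerivAt_exp_conj (K X : Mat) :
    HasDerivAt (fun s : ℝ => NormedSpace.exp (s • K) * X * NormedSpace.exp (-(s • K)))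
      (K * X - X * K) 0 := by
  have h1 := hasDerivAt_exp_smul K
  have h2 := hasDerivAt_exp_smul (-K)
  have h3 := hasDerivAt_mul (hasDerivAt_mul_mul 1 X h1) h2
  simp only [smul_neg, zero_smul, neg_zero, NormedSpace.exp_zero, one_mul, mul_one, mul_neg] at h3
  rw [sub_eq_add_neg]
  exact h3

/-- Obtained by differentiating exp(gXg⁻¹) = g exp(X) g⁻¹ at s = 0 for g = exp(sK). -/
theorem fderiv_exp_commutator (K X : Mat) :
    fderiv ℝ (NormedSpace.exp : Mat → Mat) X (K * X - X * K)
      = K * NormedSpace.exp X - NormedSpace.exp X * K := by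
  have h1 := hasDerivAt_comp_curve (t := 0) (differentiable_exp _) (hasDerivAt_exp_conj K X)
  have h2 := hasDerivAt_eq_of_eventuallyEq h1 (hasDerivAt_exp_conj K (NormedSpace.exp X))
    (Filter.Eventually.of_forall fun s => by
      have hu : NormedSpace.exp (-(s • K)) = (NormedSpace.exp (s • K))⁻¹ :=
         Matrix.exp_neg _
      simp only [hu]
      exact Matrix.exp_conj _ X (Matrix.isUnit_exp _))
  simpa using h2

/-- The divided differences of the exponential function. -/
noncomputable def expDiff (x y : ℝ) : ℝ :=
  if x = y then Real.exp x else (Real.exp x - Real.exp y) / (x - y)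

theorem expDiff_self (x : ℝ) : expDiff x x = Real.exp x := if_pos rfl

theorem expDiff_comm (x y : ℝ) : expDiff x y = expDiff y x := by
  unfold expDiff
  rcases eq_or_ne x y with rfl | h
  · rfl
  · rw [if_neg h, if_neg h.symm, ← neg_sub (Real.exp y), ← neg_sub y, neg_div_neg_eq]

theorem expDiff_pos (x y : ℝ) : 0 < expDiff x y := by
  unfold expDiff
  split_ifs with h
  · exact Real.exp_pos x
  · rcases lt_or_gt_of_ne h with h | h
    · exact div_pos_of_neg_of_neg (sub_neg.mpr (Real.exp_lt_exp.mpr h)) (sub_neg.mpr h)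
    · exact div_pos (sub_pos.mpr (Real.exp_lt_exp.mpr h)) (sub_pos.mpr h)

theorem exp_diagonal_real (x : Fin 3 → ℝ) :
    NormedSpace.exp (Matrix.diagonal x : Mat) = Matrix.diagonal fun i => Real.exp (x i) := by
  rw [Matrix.exp_diagonal]
  congr 1
  funext i
  rw [Pi.coe_exp, Real.exp_eq_exp_ℝ]

/-- The Daleckii–Krein formula for the derivative of the exponential at a diagonal matrix. -/
theorem fderiv_exp_diagonal (x : Fin 3 → ℝ) (H : Mat) :
    fderiv ℝ (NormedSpace.exp : Mat → Mat) (Matrix.diagonal x) H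
      = (Matrix.of fun i j => expDiff (x i) (x j)) ⊙ H := by
  -- Entries with x_i = x_j commute with diag x; any other entry is K_ij (x_j - x_i), an entry of a
  -- commutator. Where x_i = x_j, the value of K_ij is irrelevant, its factor being zero.
  set H₀ : Mat := Matrix.of fun i j => if x i = x j then H i j else 0 with hH₀
  set K : Mat := Matrix.of fun i j => H i j / (x j - x i) with hK
  have hsplit : H = H₀ + (K * Matrix.diagonal x - Matrix.diagonal x * K) := by
    ext i j
    simp only [hH₀, hK, Matrix.add_apply, Matrix.sub_apply, Matrix.mul_diagonal,
      Matrix.diagonal_mul, Matrix.of_apply]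
    split_ifs with h
    · simp [h]
    · have : x j - x i ≠ 0 := sub_ne_zero.mpr (Ne.symm h)
      field_simp
      ring
  have hcomm : Commute (Matrix.diagonal x) H₀ := by
    ext i j
    simp only [hH₀, Matrix.mul_diagonal, Matrix.diagonal_mul, Matrix.of_apply]
    split_ifs with h
    · rw [h, mul_comm]
    · simp
  conv_lhs => rw [hsplit]
  rw [map_add, fderiv_exp_of_commute hcomm, fderiv_exp_commutator, exp_diagonal_real]
  ext i j
  simp only [hH₀, hK, Matrix.add_apply, Matrix.sub_apply, Matrix.mul_diagonal,
      Matrix.diagonal_mul, Matrix.of_apply, Matrix.hadamard_apply, expDiff]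
  split_ifs with h
  · simp [h]
  · have h1 : x j - x i ≠ 0 := sub_ne_zero.mpr (Ne.symm h)
    have h2 : x i - x j ≠ 0 := sub_ne_zero.mpr h
    rw [← neg_sub (x j) (x i)]
    field_simp
    ring

end Calculus

/-! ### Spectral calculus: logarithm, square root and polar decomposition -/

section Spectral

theorem exists_orthogonal_diagonal {X : Mat} (hX : X.IsSymm) :
    ∃ (Q : Mat) (x : Fin 3 → ℝ), Qᵀ * Q = 1 ∧ X = Q * Matrix.diagonal x * Qᵀ := by
  have hH : X.IsHermitian := by
    rw [Matrix.IsHermitian, Matrix.conjTranspose_eq_transpose_of_trivial]; exact hX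
  refine ⟨hH.eigenvectorUnitary, hH.eigenvalues, ?_, ?_⟩
  · have := Matrix.mem_unitaryGroup_iff'.mp hH.eigenvectorUnitary.2
    rwa [Matrix.star_eq_conjTranspose, Matrix.conjTranspose_eq_transpose_of_trivial] at this
  · have := hH.spectral_theorem
    rw [Unitary.conjStarAlgAut_apply, Matrix.star_eq_conjTranspose,
      Matrix.conjTranspose_eq_transpose_of_trivial] at this
    exact this

theorem isSelfAdjoint_of_isSymm {X : Mat} (hX : X.IsSymm) : IsSelfAdjoint X := by
  rwa [IsSelfAdjoint, Matrix.star_eq_conjTranspose, Matrix.conjTranspose_eq_transpose_of_trivial]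

theorem isSymm_of_posDef {V : Mat} (hV : V.PosDef) : V.IsSymm := by
  have h := hV.isHermitian
  rwa [Matrix.IsHermitian, Matrix.conjTranspose_eq_transpose_of_trivial] at h

theorem cfc_exp_eq_exp {X : Mat} (hX : X.IsSymm) : cfc Real.exp X = NormedSpace.exp X := by
  let : NormedRing Mat := Matrix.linftyOpNormedRing
  let : NormedAlgebra ℝ Mat := Matrix.linftyOpNormedAlgebra
  exact @CFC.real_exp_eq_normedSpace_exp Mat _ _ _
    Matrix.IsHermitian.instContinuousFunctionalCalculus X (isSelfAdjoint_of_isSymm hX)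

theorem logSym_exp (X : Sym3) : logSym (NormedSpace.exp (X : Mat)) = X := by
  have hX : IsSelfAdjoint (X : Mat) := isSelfAdjoint_of_isSymm X.2
  refine Subtype.ext ?_
  change cfc Real.log (NormedSpace.exp (X : Mat)) = X
  have hcont : ContinuousOn Real.log (Real.exp '' spectrum ℝ (X : Mat)) := by
    fun_prop (disch := simp)
  rw [← cfc_exp_eq_exp X.2, ← cfc_comp' Real.log Real.exp (X : Mat) hcont]
  simp [cfc_id' (R := ℝ) (X : Mat)]

theorem spectrum_pos_of_posDef {V : Mat} (hV : V.PosDef) {x : ℝ} (hx : x ∈ spectrum ℝ V) :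
    0 < x := by
  rw [hV.isHermitian.spectrum_real_eq_range_eigenvalues] at hx
  obtain ⟨i, rfl⟩ := hx
  exact hV.eigenvalues_pos i

theorem exp_logSym {V : Mat} (hV : V.PosDef) : NormedSpace.exp (logSym V : Mat) = V := by
  have hV' : IsSelfAdjoint V := isSelfAdjoint_of_isSymm (isSymm_of_posDef hV)
  have hlog : ContinuousOn Real.log (spectrum ℝ V) :=
    Real.continuousOn_log.mono fun x hx => (spectrum_pos_of_posDef hV hx).ne'
  rw [← cfc_exp_eq_exp (logSym V).2]
  change cfc Real.exp (cfc Real.log V) = V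
  rw [← cfc_comp' Real.exp Real.log V (Real.continuous_exp.continuousOn) hlog]
  conv_rhs => rw [← cfc_id' ℝ V]
  exact cfc_congr fun x hx => Real.exp_log (spectrum_pos_of_posDef hV hx)

theorem posDef_exp {X : Mat} (hX : X.IsSymm) : (NormedSpace.exp X).PosDef := by
  have hY : ((1 / 2 : ℝ) • X).IsSymm := hX.smul _
  have h : NormedSpace.exp X =
      (NormedSpace.exp ((1 / 2 : ℝ) • X))ᴴ * NormedSpace.exp ((1 / 2 : ℝ) • X) := by
    rw [Matrix.conjTranspose_eq_transpose_of_trivial, hY.exp, exp_half_mul_self]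
  rw [h]
  exact Matrix.PosDef.conjTranspose_mul_self _
    (Matrix.mulVec_injective_of_isUnit (Matrix.isUnit_exp _))

theorem posDef_mul_transpose {F : Mat} (hF : F ∈ GLpos) : (F * Fᵀ).PosDef := by
  have hu : IsUnit F := (Matrix.isUnit_iff_isUnit_det _).mpr (ne_of_gt hF).isUnit
  rw [← Matrix.conjTranspose_eq_transpose_of_trivial]
  exact Matrix.PosDef.mul_conjTranspose_self _ (Matrix.vecMul_injective_of_isUnit hu)

theorem cfc_sqrt_exp {Y : Mat} (hY : Y.IsSymm) :
    cfc Real.sqrt (NormedSpace.exp Y) = NormedSpace.exp ((1 / 2 : ℝ) • Y) := by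
  have hY' : IsSelfAdjoint Y := isSelfAdjoint_of_isSymm hY
  rw [← cfc_exp_eq_exp hY, ← cfc_exp_eq_exp (hY.smul _),
    ← cfc_comp' Real.sqrt Real.exp Y Real.continuous_sqrt.continuousOn
      Real.continuous_exp.continuousOn,
    ← cfc_comp_smul (1 / 2 : ℝ) Real.exp Y Real.continuous_exp.continuousOn]
  refine cfc_congr fun x _ => ?_
  change √(Real.exp x) = Real.exp ((1 / 2 : ℝ) * x)
  rw [Real.sqrt_eq_iff_mul_self_eq_of_pos (Real.exp_pos _), ← Real.exp_add]
  congr 1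
  ring

/-- Through this form, positivity of V and V² = FFᵀ become facts about the exponential. -/
theorem leftStretch_eq_exp {F : Mat} (hF : F ∈ GLpos) :
    leftStretch F = NormedSpace.exp ((1 / 2 : ℝ) • (logSym (F * Fᵀ) : Mat)) := by
  rw [leftStretch, ← cfc_sqrt_exp (logSym (F * Fᵀ)).2, exp_logSym (posDef_mul_transpose hF)]

theorem posDef_leftStretch {F : Mat} (hF : F ∈ GLpos) : (leftStretch F).PosDef := by
  rw [leftStretch_eq_exp hF]
  exact posDef_exp ((logSym (F * Fᵀ)).2.smul _)

theorem leftStretch_mul_self {F : Mat} (hF : F ∈ GLpos) :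
    leftStretch F * leftStretch F = F * Fᵀ := by
  rw [leftStretch_eq_exp hF, exp_half_mul_self, exp_logSym (posDef_mul_transpose hF)]

theorem leftStretch_of_posDef {V : Mat} (hV : V.PosDef) : leftStretch V = V := by
  have hV' : IsSelfAdjoint V := isSelfAdjoint_of_isSymm (isSymm_of_posDef hV)
  have h : V * Vᵀ = cfc (fun x : ℝ => x * x) V := by
    rw [cfc_mul (fun x : ℝ => x) (fun x : ℝ => x) V, cfc_id' ℝ V, isSymm_of_posDef hV]
  rw [leftStretch, h, ← cfc_comp' Real.sqrt (fun x : ℝ => x * x) V]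
  conv_rhs => rw [← cfc_id' ℝ V]
  exact cfc_congr fun x hx => Real.sqrt_mul_self (spectrum_pos_of_posDef hV hx).le

/-- Polar decomposition `F = V R`. -/
theorem exists_polar {F : Mat} (hF : F ∈ GLpos) : ∃ R ∈ SO3, F = leftStretch F * R := by
  set V := leftStretch F with hV
  have hpos : V.PosDef := posDef_leftStretch hF
  have hdet : 0 < V.det := hpos.det_pos
  have hu : IsUnit V.det := hdet.ne'.isUnit
  -- The factor V⁻¹F is orthogonal because V² = FFᵀ, and proper because both determinants are
  -- positive.
  refine ⟨V⁻¹ * F, mem_SO3_of_mem_GLpos (mul_eq_one_comm.mp ?_) ?_,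
    (Matrix.mul_nonsing_inv_cancel_left _ _ hu).symm⟩
  · rw [Matrix.transpose_mul, Matrix.transpose_nonsing_inv, isSymm_of_posDef hpos]
    calc V⁻¹ * F * (Fᵀ * V⁻¹) = V⁻¹ * (F * Fᵀ) * V⁻¹ := by simp only [Matrix.mul_assoc]
      _ = (V⁻¹ * V) * (V * V⁻¹) := by
        rw [← leftStretch_mul_self hF, ← hV]; simp only [Matrix.mul_assoc]
      _ = 1 := by rw [Matrix.nonsing_inv_mul _ hu, Matrix.mul_nonsing_inv _ hu, Matrix.mul_one]
  · refine mul_mem_GLpos ?_ hF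
    change 0 < V⁻¹.det
    rw [Matrix.det_nonsing_inv]
    simpa using hdet

end Spectral

section Laws

/-! ### Isotropic laws and their derivatives -/

theorem differentiable_det : Differentiable ℝ (Matrix.det : Mat → ℝ) := by
  have h : (Matrix.det : Mat → ℝ) = fun F => F 0 0 * F 1 1 * F 2 2 - F 0 0 * F 1 2 * F 2 1
      - F 0 1 * F 1 0 * F 2 2 + F 0 1 * F 1 2 * F 2 0 + F 0 2 * F 1 0 * F 2 1
      - F 0 2 * F 1 1 * F 2 0 := funext fun F => Matrix.det_fin_three F
  have hentry : ∀ i j : Fin 3, Differentiable ℝ fun F : Mat => F i j := by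
    let : NormedRing Mat := Matrix.linftyOpNormedRing
    let : NormedAlgebra ℝ Mat := Matrix.linftyOpNormedAlgebra
    intro i j
    exact (LinearMap.toContinuousLinearMap (Matrix.entryLinearMap ℝ ℝ i j)).differentiable
  let : NormedRing Mat := Matrix.linftyOpNormedRing
  let : NormedAlgebra ℝ Mat := Matrix.linftyOpNormedAlgebra
  have hentry' : ∀ i j : Fin 3, Differentiable ℝ fun F : Mat => F i j := hentry
  have h' : Differentiable ℝ (Matrix.det : Mat → ℝ) := by
    rw [h]
    fun_prop
  exact h'

theorem differentiableOn_smul {g : Mat → ℝ} {f : Mat → Mat} {S : Set Mat}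
    (hg : DifferentiableOn ℝ g S) (hf : DifferentiableOn ℝ f S) :
    DifferentiableOn ℝ (fun F => g F • f F) S := by
  let : NormedRing Mat := Matrix.linftyOpNormedRing
  let : NormedAlgebra ℝ Mat := Matrix.linftyOpNormedAlgebra
  exact DifferentiableOn.smul hg hf

theorem differentiableOn_inv {g : Mat → ℝ} {S : Set Mat}
    (hg : DifferentiableOn ℝ g S) (h0 : ∀ F ∈ S, g F ≠ 0) :
    DifferentiableOn ℝ (fun F => (g F)⁻¹) S := by
  let : NormedRing Mat := Matrix.linftyOpNormedRing
  let : NormedAlgebra ℝ Mat := Matrix.linftyOpNormedAlgebra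
  exact DifferentiableOn.fun_inv hg h0

theorem differentiableOn_mul_transpose {f : Mat → Mat} {S : Set Mat}
    (hf : DifferentiableOn ℝ f S) : DifferentiableOn ℝ (fun F => f F * Fᵀ) S := by
  let : NormedRing Mat := Matrix.linftyOpNormedRing
  let : NormedAlgebra ℝ Mat := Matrix.linftyOpNormedAlgebra
  have ht : Differentiable ℝ fun F : Mat => Fᵀ :=
    (LinearMap.toContinuousLinearMap (Matrix.transposeLinearEquiv (Fin 3) (Fin 3) ℝ ℝ :
      Mat ≃ₗ[ℝ] Mat).toLinearMap).differentiable
  exact DifferentiableOn.mul hf ht.differentiableOn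

theorem isIsotropicCauchyElastic_kirchhoff {σ : Mat → Mat} (h : IsIsotropicCauchyElastic σ) :
    IsIsotropicCauchyElastic (kirchhoff σ) where
  symm F hF := (h.symm F hF).smul _
  objective F hF Q hQ := by
    rw [kirchhoff, kirchhoff, Matrix.det_mul, hQ.2, one_mul, h.objective F hF Q hQ,
      Matrix.mul_smul, Matrix.smul_mul]
  isotropic F hF Q hQ := by
    rw [kirchhoff, kirchhoff, Matrix.det_mul, hQ.2, mul_one, h.isotropic F hF Q hQ]
  differentiable := differentiableOn_smul differentiable_det.differentiableOn h.differentiable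

namespace IsIsotropicCauchyElastic

theorem differentiableAt {τ : Mat → Mat} (h : IsIsotropicCauchyElastic τ) {F : Mat}
    (hF : F ∈ GLpos) : DifferentiableAt ℝ τ F :=
  h.differentiable.differentiableAt (isOpen_GLpos.mem_nhds hF)

/-- Conjugation by any orthogonal matrix, proper or not. -/
theorem apply_conj {τ : Mat → Mat} (h : IsIsotropicCauchyElastic τ) {Q : Mat} (hQ : Qᵀ * Q = 1)
    {F : Mat} (hF : F ∈ GLpos) : τ (Q * F * Qᵀ) = Q * τ F * Qᵀ := by
  have key : ∀ R : Mat, R ∈ SO3 → τ (R * F * Rᵀ) = R * τ F * Rᵀ := fun R hR => by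
    have hRt : Rᵀ ∈ SO3 :=
      ⟨by rw [Matrix.transpose_transpose, mul_transpose_of_transpose_mul hR.1], by
        rw [Matrix.det_transpose, hR.2]⟩
    rw [h.isotropic _ (mul_mem_GLpos (mem_GLpos_of_mem_SO3 hR) hF) _ hRt, h.objective F hF R hR]
  have hdet : Q.det * Q.det = 1 := by
    have := congrArg Matrix.det hQ
    rwa [Matrix.det_mul, Matrix.det_transpose, Matrix.det_one] at this
  rcases mul_self_eq_one_iff.mp hdet with hd | hd
  · exact key Q ⟨hQ, hd⟩
  -- In odd dimension -Q is proper when Q is not, and conjugation by Q and by -Q coincide.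
  · have := key (-Q) ⟨by simpa using hQ, by rw [Matrix.det_neg, hd]; norm_num⟩
    simpa using this

theorem conj_mem_GLpos {Q : Mat} (hQ : Qᵀ * Q = 1) {F : Mat} (hF : F ∈ GLpos) :
    Q * F * Qᵀ ∈ GLpos := by
  change 0 < (Q * F * Qᵀ).det
  rw [Matrix.det_mul_comm, ← Matrix.mul_assoc, hQ, Matrix.one_mul]
  exact hF

theorem fderiv_conj {τ : Mat → Mat} (h : IsIsotropicCauchyElastic τ) {Q : Mat}
    (hQ : Qᵀ * Q = 1) {F : Mat} (hF : F ∈ GLpos) (H : Mat) :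
    fderiv ℝ τ (Q * F * Qᵀ) (Q * H * Qᵀ) = Q * fderiv ℝ τ F H * Qᵀ :=
  fderiv_mul_mul isOpen_GLpos h.differentiable (fun _ => conj_mem_GLpos hQ)
    (fun _ => h.apply_conj hQ) hF H

theorem fderiv_mul_right {τ : Mat → Mat} (h : IsIsotropicCauchyElastic τ) {R : Mat}
    (hR : R ∈ SO3) {F : Mat} (hF : F ∈ GLpos) (H : Mat) :
    fderiv ℝ τ (F * R) (H * R) = fderiv ℝ τ F H := by
  have := fderiv_mul_mul (P := 1) (Q := R) (M := 1) (N := 1) isOpen_GLpos h.differentiable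
    (fun G hG => by simpa using mul_mem_GLpos hG (mem_GLpos_of_mem_SO3 hR))
    (fun G hG => by simpa using h.isotropic G hG R hR) hF H
  simpa using this

/-- Infinitesimal isotropy: the stress is constant along s ↦ F exp(sΩ). -/
theorem fderiv_mul_skew {τ : Mat → Mat} (h : IsIsotropicCauchyElastic τ) {Ω : Mat}
    (hΩ : Ωᵀ = -Ω) {F : Mat} (hF : F ∈ GLpos) : fderiv ℝ τ F (F * Ω) = 0 := by
  have hc := hasDerivAt_mul_mul F 1 (hasDerivAt_exp_smul Ω)
  simp only [Matrix.mul_one] at hc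
  have hF0 : F * NormedSpace.exp ((0 : ℝ) • Ω) = F := by simp
  have h1 := hasDerivAt_comp_curve (f := τ) (by rw [hF0]; exact h.differentiableAt hF) hc
  have h2 := hasDerivAt_eq_of_eventuallyEq h1 (hasDerivAt_const_curve (τ F) 0)
    (Filter.Eventually.of_forall fun s => h.isotropic F hF _ (exp_mem_SO3 (by
      rw [Matrix.transpose_smul, hΩ, smul_neg])))
  rwa [hF0] at h2

/-- Infinitesimal objectivity: along s ↦ exp(sΩ)F the stress is conjugated by exp(sΩ). -/
theorem fderiv_skew_mul {τ : Mat → Mat} (h : IsIsotropicCauchyElastic τ) {Ω : Mat}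
    (hΩ : Ωᵀ = -Ω) {F : Mat} (hF : F ∈ GLpos) :
    fderiv ℝ τ F (Ω * F) = Ω * τ F - τ F * Ω := by
  have hc := hasDerivAt_mul_mul 1 F (hasDerivAt_exp_smul Ω)
  simp only [Matrix.one_mul] at hc
  have hF0 : NormedSpace.exp ((0 : ℝ) • Ω) * F = F := by simp
  have h1 := hasDerivAt_comp_curve (f := τ) (by rw [hF0]; exact h.differentiableAt hF) hc
  have h2 := hasDerivAt_eq_of_eventuallyEq h1 (hasDerivAt_exp_conj Ω (τ F))
    (Filter.Eventually.of_forall fun s => by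
      have hs : (s • Ω)ᵀ = -(s • Ω) := by rw [Matrix.transpose_smul, hΩ, smul_neg]
      rw [h.objective F hF _ (exp_mem_SO3 hs), ← Matrix.exp_transpose, hs])
  rwa [hF0] at h2

end IsIsotropicCauchyElastic

/-! ### The corotational condition as positivity of a quadratic form -/

/-- The spin drops out of the corotational rate by infinitesimal objectivity, and every symmetric D
is realised by a spin-free history. -/
theorem corotationalAt_iff {τ : Mat → Mat} (h : IsIsotropicCauchyElastic τ) {F : Mat}
    (hF : F ∈ GLpos) :
    CorotationalAt τ F ↔
      ∀ D : Mat, D.IsSymm → D ≠ 0 → 0 < frob (fderiv ℝ τ F (D * F)) D := by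
  have hu : IsUnit F.det := (ne_of_gt hF).isUnit
  constructor
  · intro hco D hD hD0
    -- This history stays in GL⁺(3) and has velocity gradient D, hence zero vorticity, at time 0.
    set c : ℝ → Mat := fun s => NormedSpace.exp (s • D) * F with hc
    have hdiff : Differentiable ℝ c := by
      let : NormedRing Mat := Matrix.linftyOpNormedRing
      let : NormedAlgebra ℝ Mat := Matrix.linftyOpNormedAlgebra
      exact fun s => (HasDerivAt.mul_const (hasDerivAt_exp_smul_const D s) F).differentiableAt
    have hc0 : c 0 = F := by simp [hc]
    have hd0 : HasDerivAt c (D * F) 0 := by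
      simpa using hasDerivAt_mul_mul 1 F (hasDerivAt_exp_smul D)
    have hvel : velGrad c 0 = D := by
      rw [velGrad, deriv_eq_of_hasDerivAt hd0, hc0, Matrix.mul_nonsing_inv_cancel_right _ _ hu]
    have hrate : strainRate c 0 = D := by
      rw [strainRate, hvel, sym, hD, ← two_smul ℝ D, smul_smul]
      norm_num
    have hvort : vorticity c 0 = 0 := by
      rw [vorticity, hvel, skew, hD, sub_self, smul_zero]
    have hτ : deriv (fun s => τ (c s)) 0 = fderiv ℝ τ F (D * F) := by
      have := deriv_eq_of_hasDerivAt
        (hasDerivAt_comp_curve (f := τ) (by rw [hc0]; exact h.differentiableAt hF) hd0)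
      rwa [hc0] at this
    have := hco c 0 hdiff
      (fun s => mul_mem_GLpos (exp_mem_GLpos _) hF) hc0 (by rwa [hrate])
    rwa [zjRate, hrate, hvort, hτ, Matrix.mul_zero, Matrix.zero_mul, add_zero, sub_zero] at this
  · intro hpos c t hc _ hct hD0
    have hsymm : (strainRate c t).IsSymm := by
      rw [Matrix.IsSymm, strainRate, sym, Matrix.transpose_smul, Matrix.transpose_add,
        Matrix.transpose_transpose, add_comm]
    have hskew : (vorticity c t)ᵀ = -vorticity c t := by
      rw [vorticity, skew, Matrix.transpose_smul, Matrix.transpose_sub,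
        Matrix.transpose_transpose, ← smul_neg, neg_sub]
    have hsplit : deriv c t = strainRate c t * F + vorticity c t * F := by
      have hL : strainRate c t + vorticity c t = velGrad c t := by
        rw [strainRate, vorticity, sym, skew, ← smul_add, add_add_sub_cancel, ← two_smul ℝ,
          smul_smul]
        norm_num
      rw [← Matrix.add_mul, hL, velGrad, hct, Matrix.nonsing_inv_mul_cancel_right _ _ hu]
    have hτ : deriv (fun s => τ (c s)) t = fderiv ℝ τ F (deriv c t) := by
      have := deriv_eq_of_hasDerivAt (hasDerivAt_comp_curve (f := τ)
        (by rw [hct]; exact h.differentiableAt hF) (hasDerivAt_deriv (hc t)))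
      rwa [hct] at this
    -- The spin part of the derivative is Wτ - τW, which cancels the corotational terms.
    have hz : zjRate τ c t = fderiv ℝ τ F (strainRate c t * F) := by
      rw [zjRate, hτ, hsplit, map_add, h.fderiv_skew_mul hskew hF, hct]
      abel
    rw [hz]
    exact hpos _ hsymm hD0

theorem corotationalAt_mul_right_iff {τ : Mat → Mat} (h : IsIsotropicCauchyElastic τ)
    {F R : Mat} (hF : F ∈ GLpos) (hR : R ∈ SO3) :
    CorotationalAt τ (F * R) ↔ CorotationalAt τ F := by
  rw [corotationalAt_iff h hF,
    corotationalAt_iff h (mul_mem_GLpos hF (mem_GLpos_of_mem_SO3 hR))]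
  simp only [← Matrix.mul_assoc, h.fderiv_mul_right hR hF]

end Laws

section Diagonal

/-! ### Comparison of the two quadratic forms in an eigenbasis of the strain -/

/-- The entrywise factor that turns a rate of the logarithmic strain `diag x` into the strain
rate `D`. -/
noncomputable def logWeight (x : Fin 3 → ℝ) : Mat := Matrix.of fun i j =>
  expDiff (x i) (x j) * (Real.exp (x i) + Real.exp (x j)) / (Real.exp (x i) ^ 2 + Real.exp (x j) ^ 2)

theorem logWeight_pos (x : Fin 3 → ℝ) (i j : Fin 3) : 0 < logWeight x i j := by
  have := expDiff_pos (x i) (x j)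
  rw [logWeight, Matrix.of_apply]
  positivity

theorem logWeight_comm (x : Fin 3 → ℝ) (i j : Fin 3) : logWeight x i j = logWeight x j i := by
  simp only [logWeight, Matrix.of_apply]
  rw [expDiff_comm, add_comm (Real.exp (x i)), add_comm (Real.exp (x i) ^ 2)]

theorem logWeight_self (x : Fin 3 → ℝ) (i : Fin 3) : logWeight x i i = 1 := by
  have := Real.exp_pos (x i)
  rw [logWeight, Matrix.of_apply, expDiff_self]
  field_simp

/-- With d the divided difference, a symmetric D and a skew Ω must satisfy d H_ij = D_ij e^{x_j} +
e^{x_i} Ω_ij and d H_ij = D_ij e^{x_i} - e^{x_j} Ω_ij, the entries (i,j) and (j,i). Solving this 2×2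
system gives `logWeight` as the factor from H_ij to D_ij. -/
theorem fderiv_exp_diagonal_eq_add (x : Fin 3 → ℝ) {H : Mat} (hH : H.IsSymm) :
    ∃ Ω : Mat, Ωᵀ = -Ω ∧ fderiv ℝ (NormedSpace.exp : Mat → Mat) (Matrix.diagonal x) H =
      (logWeight x ⊙ H) * NormedSpace.exp (Matrix.diagonal x : Mat) +
        NormedSpace.exp (Matrix.diagonal x : Mat) * Ω := by
  refine ⟨Matrix.of fun i j => logWeight x i j * H i j *
    ((Real.exp (x i) - Real.exp (x j)) / (Real.exp (x i) + Real.exp (x j))), ?_, ?_⟩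
  · ext i j
    have hij := hH.apply i j
    simp only [Matrix.transpose_apply, Matrix.neg_apply, Matrix.of_apply]
    rw [logWeight_comm, hij, add_comm (Real.exp (x j)), ← neg_sub (Real.exp (x i)), neg_div,
      mul_neg]
  · rw [fderiv_exp_diagonal, exp_diagonal_real]
    ext i j
    have hi := Real.exp_pos (x i)
    have hj := Real.exp_pos (x j)
    simp only [Matrix.add_apply, Matrix.mul_diagonal, Matrix.diagonal_mul, Matrix.of_apply,
      Matrix.hadamard_apply, logWeight]
    field_simp
    ring

/-- The diagonal reflection that changes the sign of the `k`-th axis. -/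
def reflection (k : Fin 3) : Mat := Matrix.diagonal fun i => if i = k then -1 else 1

theorem reflection_transpose (k : Fin 3) : (reflection k)ᵀ = reflection k :=
  Matrix.diagonal_transpose _

theorem reflection_orthogonal (k : Fin 3) : (reflection k)ᵀ * reflection k = 1 := by
  rw [reflection_transpose, reflection, Matrix.diagonal_mul_diagonal, ← Matrix.diagonal_one]
  congr 1
  funext i
  split_ifs <;> norm_num

theorem reflection_mul_diagonal (k : Fin 3) (x : Fin 3 → ℝ) :
    reflection k * Matrix.diagonal x * (reflection k)ᵀ = Matrix.diagonal x := by
  rw [reflection_transpose, reflection, Matrix.diagonal_mul_diagonal, Matrix.diagonal_mul_diagonal]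
  congr 1
  funext i
  split_ifs <;> ring

theorem reflection_conj_apply (k : Fin 3) (A : Mat) (i j : Fin 3) :
    (reflection k * A * (reflection k)ᵀ) i j =
      (if i = k then -1 else 1) * (if j = k then -1 else 1) * A i j := by
  rw [reflection_transpose, reflection, Matrix.mul_diagonal, Matrix.diagonal_mul]
  ring

/-- Reflecting the i-th axis flips the sign of each off-diagonal entry in row i. -/
theorem eq_diagonal_of_reflection {A : Mat}
    (hA : ∀ k, reflection k * A * (reflection k)ᵀ = A) : A = Matrix.diagonal A.diag := by
  ext i j
  rcases eq_or_ne i j with rfl | hij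
  · simp
  · have h := congrFun (congrFun (hA i) i) j
    rw [reflection_conj_apply, if_pos rfl, if_neg hij.symm] at h
    rw [Matrix.diagonal_apply_ne _ hij]
    linarith

/-- The sign characters of the axis reflections determine an unordered pair of indices, up to the
ambiguity between diagonal pairs. -/
theorem eq_or_eq_of_reflection_sign {i j a b : Fin 3}
    (h : ∀ k : Fin 3, ((if i = k then -1 else 1) * (if j = k then -1 else 1) : ℤ) =
      (if a = k then -1 else 1) * (if b = k then -1 else 1)) :
    (i = j ∧ a = b) ∨ (i = a ∧ j = b) ∨ (i = b ∧ j = a) := by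
  revert i j a b
  decide

/-- A linear map that commutes with the axis reflections commutes with entrywise multiplication
by a symmetric matrix with unit diagonal. -/
theorem map_hadamard_of_reflection {L : Mat →ₗ[ℝ] Mat}
    (hL : ∀ k A, L (reflection k * A * (reflection k)ᵀ) = reflection k * L A * (reflection k)ᵀ)
    {s : Mat} (hs : ∀ i j, s i j = s j i) (hs1 : ∀ i, s i i = 1) (A : Mat) :
    L (s ⊙ A) = s ⊙ L A := by
  have hexp : ∀ B : Mat, ∀ a b, L B a b = ∑ i, ∑ j, B i j * L (Matrix.single i j 1) a b := by
    intro B a b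
    conv_lhs => rw [Matrix.matrix_eq_sum_single B]
    simp only [map_sum, Matrix.sum_apply]
    refine Finset.sum_congr rfl fun i _ => Finset.sum_congr rfl fun j _ => ?_
    have : Matrix.single i j (B i j) = B i j • (Matrix.single i j 1 : Mat) := by
      rw [Matrix.smul_single, smul_eq_mul, mul_one]
    rw [this, map_smul, Matrix.smul_apply, smul_eq_mul]
  -- Each matrix unit is a simultaneous eigenvector of the reflections, so L can only link units
  -- with the same sign character: two diagonal ones, or the same unordered pair. The multiplier s
  -- agrees on both in either case.
  have hcoef : ∀ i j a b, L (Matrix.single i j 1) a b ≠ 0 → s i j = s a b := by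
    intro i j a b hne
    have hsign : ∀ k : Fin 3, ((if i = k then -1 else 1) * (if j = k then -1 else 1) : ℤ) =
        (if a = k then -1 else 1) * (if b = k then -1 else 1) := by
      intro k
      have hrefl : reflection k * Matrix.single i j 1 * (reflection k)ᵀ =
          ((if i = k then -1 else 1) * (if j = k then -1 else 1) : ℝ) •
            (Matrix.single i j 1 : Mat) := by
        ext p q
        rw [reflection_conj_apply, Matrix.smul_apply, smul_eq_mul, Matrix.single_apply]
        by_cases hpq : i = p ∧ j = q
        · rw [hpq.1, hpq.2]
        · rw [if_neg hpq, mul_zero, mul_zero]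
      have h := congrFun (congrFun (hL k (Matrix.single i j 1)) a) b
      rw [hrefl, map_smul, Matrix.smul_apply, smul_eq_mul, reflection_conj_apply] at h
      exact_mod_cast mul_right_cancel₀ hne h
    rcases eq_or_eq_of_reflection_sign hsign with ⟨rfl, rfl⟩ | ⟨rfl, rfl⟩ | ⟨rfl, rfl⟩
    · rw [hs1, hs1]
    · rfl
    · exact hs _ _
  ext a b
  rw [Matrix.hadamard_apply, hexp, hexp, Finset.mul_sum]
  refine Finset.sum_congr rfl fun i _ => ?_
  rw [Finset.mul_sum]
  refine Finset.sum_congr rfl fun j _ => ?_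
  rw [Matrix.hadamard_apply]
  by_cases hne : L (Matrix.single i j 1) a b = 0
  · rw [hne, mul_zero, mul_zero, mul_zero]
  · rw [hcoef i j a b hne, mul_assoc]

theorem fderiv_comp_exp_diagonal {τ : Mat → Mat} (h : IsIsotropicCauchyElastic τ)
    (x : Fin 3 → ℝ) {H : Mat} (hH : H.IsSymm) :
    fderiv ℝ τ (NormedSpace.exp (Matrix.diagonal x : Mat))
        (fderiv ℝ (NormedSpace.exp : Mat → Mat) (Matrix.diagonal x) H) =
      fderiv ℝ τ (NormedSpace.exp (Matrix.diagonal x : Mat))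
        ((logWeight x ⊙ H) * NormedSpace.exp (Matrix.diagonal x : Mat)) := by
  obtain ⟨Ω, hΩ, hE⟩ := fderiv_exp_diagonal_eq_add x hH
  rw [hE, map_add, h.fderiv_mul_skew hΩ (exp_mem_GLpos _), add_zero]

/-- The derivative of the law along `D V`, as a linear function of `D`. -/
noncomputable def rateMap (τ : Mat → Mat) (V : Mat) : Mat →ₗ[ℝ] Mat where
  toFun D := fderiv ℝ τ V (D * V)
  map_add' D E := by rw [Matrix.add_mul, map_add]
  map_smul' c D := by rw [Matrix.smul_mul, map_smul, RingHom.id_apply]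

/-- Used twice: with the reflections, which fix a diagonal V, and with the rotation to an
eigenbasis. -/
theorem rateMap_conj {τ : Mat → Mat} (h : IsIsotropicCauchyElastic τ) {Q : Mat}
    (hQ : Qᵀ * Q = 1) {V : Mat} (hV : V ∈ GLpos) (D : Mat) :
    rateMap τ (Q * V * Qᵀ) (Q * D * Qᵀ) = Q * rateMap τ V D * Qᵀ := by
  have hprod : Q * D * Qᵀ * (Q * V * Qᵀ) = Q * (D * V) * Qᵀ := by
    calc Q * D * Qᵀ * (Q * V * Qᵀ) = Q * D * (Qᵀ * Q) * V * Qᵀ := by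
          simp only [Matrix.mul_assoc]
      _ = Q * (D * V) * Qᵀ := by rw [hQ, Matrix.mul_one]; simp only [Matrix.mul_assoc]
  change fderiv ℝ τ (Q * V * Qᵀ) (Q * D * Qᵀ * (Q * V * Qᵀ)) = Q * fderiv ℝ τ V (D * V) * Qᵀ
  rw [hprod, h.fderiv_conj hQ hV]

theorem isSymm_conj_iff {Q : Mat} (hQ : Qᵀ * Q = 1) {H : Mat} :
    (Q * H * Qᵀ).IsSymm ↔ H.IsSymm := by
  have hback : ∀ A : Mat, Qᵀ * (Q * A * Qᵀ) * Q = A := fun A => by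
    calc Qᵀ * (Q * A * Qᵀ) * Q = (Qᵀ * Q) * A * (Qᵀ * Q) := by simp only [Matrix.mul_assoc]
      _ = A := by rw [hQ, Matrix.one_mul, Matrix.mul_one]
  have ht : (Q * H * Qᵀ)ᵀ = Q * Hᵀ * Qᵀ := by
    simp only [Matrix.transpose_mul, Matrix.transpose_transpose, Matrix.mul_assoc]
  rw [Matrix.IsSymm, ht, Matrix.IsSymm]
  exact ⟨fun h => by rw [← hback Hᵀ, h, hback], fun h => by rw [h]⟩

/-- In an eigenbasis, the two quadratic forms differ by an entrywise rescaling. -/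
theorem forall_frob_diagonal_iff {τ : Mat → Mat} (h : IsIsotropicCauchyElastic τ)
    (x : Fin 3 → ℝ) :
    (∀ D : Mat, D.IsSymm → D ≠ 0 →
        0 < frob (rateMap τ (NormedSpace.exp (Matrix.diagonal x : Mat)) D) D) ↔
      ∀ H : Mat, H.IsSymm → H ≠ 0 →
        0 < frob (fderiv ℝ τ (NormedSpace.exp (Matrix.diagonal x : Mat))
          (fderiv ℝ (NormedSpace.exp : Mat → Mat) (Matrix.diagonal x) H)) H := by
  set V : Mat := NormedSpace.exp (Matrix.diagonal x : Mat) with hV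
  -- The square root lets the weight be shared equally between the two slots of the form.
  set s : Mat := Matrix.of fun i j => √(logWeight x i j) with hs
  have hs_pos : ∀ i j, 0 < s i j := fun i j => Real.sqrt_pos.mpr (logWeight_pos x i j)
  have hs_comm : ∀ i j, s i j = s j i := fun i j => by
    simp only [hs, Matrix.of_apply, logWeight_comm x i j]
  have hs_one : ∀ i, s i i = 1 := fun i => by
    simp only [hs, Matrix.of_apply, logWeight_self, Real.sqrt_one]
  have hs_sq : ∀ H : Mat, logWeight x ⊙ H = s ⊙ (s ⊙ H) := fun H => by
    ext i j
    simp only [Matrix.hadamard_apply, hs, Matrix.of_apply]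
    rw [← mul_assoc, Real.mul_self_sqrt (logWeight_pos x i j).le]
  have hL : ∀ k A, rateMap τ V (reflection k * A * (reflection k)ᵀ) =
      reflection k * rateMap τ V A * (reflection k)ᵀ := fun k A => by
    have := rateMap_conj h (reflection_orthogonal k) (exp_mem_GLpos (Matrix.diagonal x)) A
    rwa [← exp_conj_orthogonal (reflection_orthogonal k), reflection_mul_diagonal] at this
  have key : ∀ H : Mat, H.IsSymm → frob (fderiv ℝ τ V
      (fderiv ℝ (NormedSpace.exp : Mat → Mat) (Matrix.diagonal x) H)) H =
        frob (rateMap τ V (s ⊙ H)) (s ⊙ H) := fun H hH => by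
    rw [fderiv_comp_exp_diagonal h x hH]
    change frob (rateMap τ V (logWeight x ⊙ H)) H = _
    rw [hs_sq, map_hadamard_of_reflection hL hs_comm hs_one, frob_hadamard]
  have hsymm : ∀ r : Mat, (∀ i j, r i j = r j i) → ∀ H : Mat, H.IsSymm → (r ⊙ H).IsSymm :=
    fun r hr H hH => by
      ext i j
      rw [Matrix.transpose_apply, Matrix.hadamard_apply, Matrix.hadamard_apply, hr j i,
        hH.apply i j]
  constructor
  · intro hpos H hH hH0
    rw [key H hH]
    refine hpos _ (hsymm s hs_comm H hH) fun h0 => hH0 ?_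
    ext i j
    have := congrFun (congrFun h0 i) j
    rw [Matrix.hadamard_apply] at this
    exact (mul_eq_zero.mp this).resolve_left (hs_pos i j).ne'
  · intro hpos D hD hD0
    -- The entrywise inverse of s shows that H ↦ s ⊙ H is onto the symmetric matrices.
    set r : Mat := Matrix.of fun i j => (s i j)⁻¹ with hr
    have hrD : (r ⊙ D).IsSymm := hsymm r (fun i j => by
      simp only [hr, Matrix.of_apply, hs_comm i j]) D hD
    have hback : s ⊙ (r ⊙ D) = D := by
      ext i j
      simp only [Matrix.hadamard_apply, hr, Matrix.of_apply]
      rw [mul_inv_cancel_left₀ (hs_pos i j).ne']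
    have := hpos (r ⊙ D) hrD fun h0 => hD0 (by rw [← hback, h0, Matrix.hadamard_zero])
    rwa [key _ hrD, hback] at this

theorem forall_isSymm_conj {Q : Mat} (hQ : Qᵀ * Q = 1) {p : Mat → Prop} :
    (∀ H : Mat, H.IsSymm → H ≠ 0 → p H) ↔ ∀ H : Mat, H.IsSymm → H ≠ 0 → p (Q * H * Qᵀ) := by
  have hinv : ∀ H : Mat, Q * (Qᵀ * H * Q) * Qᵀ = H := fun H => by
    calc Q * (Qᵀ * H * Q) * Qᵀ = (Q * Qᵀ) * H * (Q * Qᵀ) := by simp only [Matrix.mul_assoc]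
      _ = H := by rw [mul_transpose_of_transpose_mul hQ, Matrix.one_mul, Matrix.mul_one]
  have hinv' : ∀ H : Mat, Qᵀ * (Q * H * Qᵀ) * Q = H := fun H => by
    calc Qᵀ * (Q * H * Qᵀ) * Q = (Qᵀ * Q) * H * (Qᵀ * Q) := by simp only [Matrix.mul_assoc]
      _ = H := by rw [hQ, Matrix.one_mul, Matrix.mul_one]
  constructor
  · intro hp H hH hH0
    exact hp _ ((isSymm_conj_iff hQ).mpr hH) fun h0 => hH0 (by
      rw [← hinv' H, h0, Matrix.mul_zero, Matrix.zero_mul])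
  · intro hp H hH hH0
    rw [← hinv H]
    refine hp _ ((isSymm_conj_iff hQ).mp (by rwa [hinv])) fun h0 => hH0 ?_
    rw [← hinv H, h0, Matrix.mul_zero, Matrix.zero_mul]

/-- Everything involved is equivariant under orthogonal conjugation, so an eigenbasis of X may be
assumed. -/
theorem forall_frob_rateMap_iff {τ : Mat → Mat} (h : IsIsotropicCauchyElastic τ)
    {X : Mat} (hX : X.IsSymm) :
    (∀ D : Mat, D.IsSymm → D ≠ 0 → 0 < frob (rateMap τ (NormedSpace.exp X) D) D) ↔
      ∀ H : Mat, H.IsSymm → H ≠ 0 → 0 < frob (fderiv ℝ τ (NormedSpace.exp X)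
        (fderiv ℝ (NormedSpace.exp : Mat → Mat) X H)) H := by
  obtain ⟨Q, x, hQ, rfl⟩ := exists_orthogonal_diagonal hX
  rw [forall_isSymm_conj hQ, forall_isSymm_conj hQ
    (p := fun H => 0 < frob (fderiv ℝ τ (NormedSpace.exp (Q * Matrix.diagonal x * Qᵀ))
        (fderiv ℝ (NormedSpace.exp : Mat → Mat) (Q * Matrix.diagonal x * Qᵀ) H)) H)]
  simp only [exp_conj_orthogonal hQ, rateMap_conj h hQ (exp_mem_GLpos _), fderiv_exp_conj hQ,
    h.fderiv_conj hQ (exp_mem_GLpos _), frob_conj hQ]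
  exact forall_frob_diagonal_iff h x

end Diagonal

section Tangent

/-! ### The tangent of the Kirchhoff stress in the logarithmic strain -/

theorem hasFDerivAt_hatTau {σ : Mat → Mat} (h : IsIsotropicCauchyElastic σ) (X : Sym3) :
    HasFDerivAt (hatTau σ) (((fderiv ℝ (kirchhoff σ) (NormedSpace.exp (X : Mat))).comp
      (fderiv ℝ (NormedSpace.exp : Mat → Mat) X)).comp Sym3.subtypeL) X := by
  have hτ := (isIsotropicCauchyElastic_kirchhoff h).differentiableAt (exp_mem_GLpos (X : Mat))
  have hexp := differentiable_exp (X : Mat)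
  let : NormedRing Mat := Matrix.linftyOpNormedRing
  let : NormedAlgebra ℝ Mat := Matrix.linftyOpNormedAlgebra
  have hincl : HasFDerivAt (fun Y : Sym3 => (Y : Mat)) Sym3.subtypeL X :=
    Sym3.subtypeL.hasFDerivAt
  exact ((DifferentiableAt.hasFDerivAt hτ).comp (X : Mat)
    (DifferentiableAt.hasFDerivAt hexp)).comp X hincl

theorem differentiable_hatTau {σ : Mat → Mat} (h : IsIsotropicCauchyElastic σ) :
    Differentiable ℝ (hatTau σ) := fun X =>
  (hasFDerivAt_hatTau h X).differentiableAt

theorem fderiv_hatTau_apply {σ : Mat → Mat} (h : IsIsotropicCauchyElastic σ) (X H : Sym3) :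
    fderiv ℝ (hatTau σ) X H = fderiv ℝ (kirchhoff σ) (NormedSpace.exp (X : Mat))
      (fderiv ℝ (NormedSpace.exp : Mat → Mat) X H) := by
  have hd := hasFDerivAt_hatTau h X
  have : fderiv ℝ (hatTau σ) X = ((fderiv ℝ (kirchhoff σ) (NormedSpace.exp (X : Mat))).comp
      (fderiv ℝ (NormedSpace.exp : Mat → Mat) X)).comp Sym3.subtypeL := by
    let : NormedRing Mat := Matrix.linftyOpNormedRing
    let : NormedAlgebra ℝ Mat := Matrix.linftyOpNormedAlgebra
    exact HasFDerivAt.fderiv hd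
  rw [this]
  rfl

/-- A bilinear form and its symmetric part have the same quadratic form. -/
theorem isSymPosDef4_symPart_iff {σ : Mat → Mat} {X : Sym3} :
    IsSymPosDef4 (symPart (tangent σ X)) ↔
      ∀ H : Sym3, H ≠ 0 → 0 < frob (fderiv ℝ (hatTau σ) X H) (H : Mat) := by
  have hval : ∀ H K, symPart (tangent σ X) H K =
      1 / 2 * (tangent σ X H K + tangent σ X K H) := fun H K => rfl
  have hdiag : ∀ H, symPart (tangent σ X) H H = frob (fderiv ℝ (hatTau σ) X H) (H : Mat) :=
    fun H => by
      rw [hval, ← two_mul, ← mul_assoc, one_div_mul_cancel two_ne_zero, one_mul]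
      rfl
  constructor
  · intro h H hH
    rw [← hdiag]
    exact h.2 H hH
  · intro h
    refine ⟨fun H K => ?_, fun H hH => ?_⟩
    · rw [hval, hval, add_comm]
    · rw [hdiag]
      exact h H hH

theorem corotationalAt_exp_iff {σ : Mat → Mat} (h : IsIsotropicCauchyElastic σ) (X : Sym3) :
    CorotationalAt (kirchhoff σ) (NormedSpace.exp (X : Mat)) ↔
      IsSymPosDef4 (symPart (tangent σ X)) := by
  have hτ := isIsotropicCauchyElastic_kirchhoff h
  rw [corotationalAt_iff hτ (exp_mem_GLpos _), isSymPosDef4_symPart_iff]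
  refine (forall_frob_rateMap_iff hτ X.2).trans ?_
  simp only [fderiv_hatTau_apply h]
  exact ⟨fun hp H hH => hp H H.2 fun h0 => hH (Subtype.ext h0),
    fun hp H hH hH0 => hp ⟨H, hH⟩ fun h0 => hH0 (congrArg Subtype.val h0)⟩

theorem kirchhoff_eq_hatTau {σ : Mat → Mat} (h : IsIsotropicCauchyElastic σ) {F : Mat}
    (hF : F ∈ GLpos) : kirchhoff σ F = hatTau σ (logSym (leftStretch F)) := by
  obtain ⟨R, hR, hFR⟩ := exists_polar hF
  have hV := posDef_leftStretch hF
  rw [hatTau, exp_logSym hV]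
  conv_lhs => rw [hFR]
  exact (isIsotropicCauchyElastic_kirchhoff h).isotropic _ hV.det_pos R hR

theorem corotationalAt_iff_isSymPosDef4 {σ : Mat → Mat} (h : IsIsotropicCauchyElastic σ)
    {F : Mat} (hF : F ∈ GLpos) :
    CorotationalAt (kirchhoff σ) F ↔
      IsSymPosDef4 (symPart (tangent σ (logSym (leftStretch F)))) := by
  obtain ⟨R, hR, hFR⟩ := exists_polar hF
  have hV := posDef_leftStretch hF
  rw [← corotationalAt_exp_iff h, exp_logSym hV]
  conv_lhs => rw [hFR]
  exact corotationalAt_mul_right_iff (isIsotropicCauchyElastic_kirchhoff h) hV.det_pos hR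

theorem forall_corotationalAt_iff {σ : Mat → Mat} (h : IsIsotropicCauchyElastic σ) :
    (∀ F ∈ GLpos, CorotationalAt (kirchhoff σ) F) ↔
      ∀ V : Mat, V.PosDef → IsSymPosDef4 (symPart (tangent σ (logSym V))) := by
  constructor
  · intro hco V hV
    have hVG : V ∈ GLpos := hV.det_pos
    have := (corotationalAt_iff_isSymPosDef4 h hVG).mp (hco V hVG)
    rwa [leftStretch_of_posDef hV] at this
  · intro hpos F hF
    exact (corotationalAt_iff_isSymPosDef4 h hF).mpr (hpos _ (posDef_leftStretch hF))

/-! ### Strict monotonicity -/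

theorem hasDerivAt_frob {c : ℝ → Mat} {t : ℝ} {c' : Mat} (hc : HasDerivAt c c' t) (K : Mat) :
    HasDerivAt (fun s => frob (c s) K) (frob c' K) t := by
  let : NormedRing Mat := Matrix.linftyOpNormedRing
  let : NormedAlgebra ℝ Mat := Matrix.linftyOpNormedAlgebra
  let ℓ : Mat →L[ℝ] ℝ := LinearMap.toContinuousLinearMap
    { toFun := fun A => frob A K
      map_add' := fun A B => by simp [frob, Matrix.add_mul]
      map_smul' := fun r A => by simp [frob] }
  exact ℓ.hasFDerivAt.comp_hasDerivAt t hc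

theorem hasDerivAt_hatTau_line {σ : Mat → Mat} (h : IsIsotropicCauchyElastic σ) (X H : Sym3)
    (t : ℝ) : HasDerivAt (fun s : ℝ => hatTau σ (X + s • H))
      (fderiv ℝ (hatTau σ) (X + t • H) H) t := by
  have hd := differentiable_hatTau h (X + t • H)
  let : NormedRing Mat := Matrix.linftyOpNormedRing
  let : NormedAlgebra ℝ Mat := Matrix.linftyOpNormedAlgebra
  have hline : HasDerivAt (fun s : ℝ => X + s • H) H t := by
    have := ((hasDerivAt_id t).smul_const H).const_add X
    rw [one_smul] at this
    exact this
  exact (DifferentiableAt.hasFDerivAt hd).comp_hasDerivAt t hline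

theorem strictlyMonotoneInLog_of_isSymPosDef4 {σ : Mat → Mat} (h : IsIsotropicCauchyElastic σ)
    (hpos : ∀ V : Mat, V.PosDef → IsSymPosDef4 (symPart (tangent σ (logSym V)))) :
    StrictlyMonotoneInLog σ := by
  intro V₁ V₂ hV₁ hV₂ hne
  set X₁ := logSym V₁ with hX₁
  set X₂ := logSym V₂ with hX₂
  have hX : X₁ - X₂ ≠ 0 := fun h0 => hne (by
    rw [← exp_logSym hV₁, ← exp_logSym hV₂, ← hX₁, ← hX₂, sub_eq_zero.mp h0])
  have hderiv := fun t : ℝ =>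
    hasDerivAt_frob (hasDerivAt_hatTau_line h X₂ (X₁ - X₂) t) ((X₁ - X₂ : Sym3) : Mat)
  -- Sym(3) is convex and each of its points is the logarithm of a positive definite matrix, so the
  -- hypothesis applies all along the segment from X₂ to X₁.
  have hmono : StrictMono fun t : ℝ =>
      frob (hatTau σ (X₂ + t • (X₁ - X₂))) ((X₁ - X₂ : Sym3) : Mat) := by
    refine strictMono_of_deriv_pos fun t => ?_
    rw [(hderiv t).deriv]
    have := hpos _ (posDef_exp (X₂ + t • (X₁ - X₂)).2)
    rw [logSym_exp, isSymPosDef4_symPart_iff] at this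
    exact this _ hX
  have h01 := hmono one_pos
  simp only [zero_smul, one_smul, add_zero, add_sub_cancel] at h01
  have hsub : frob (hatTau σ X₁ - hatTau σ X₂) (X₁ - X₂ : Mat) =
      frob (hatTau σ X₁) ((X₁ - X₂ : Sym3) : Mat) -
        frob (hatTau σ X₂) ((X₁ - X₂ : Sym3) : Mat) := by
    simp only [frob, Matrix.sub_mul, Matrix.trace_sub, Submodule.coe_sub]
  rw [hsub]
  exact sub_pos.mpr h01

end Tangent

section Hyperelastic

/-! ### Hyperelastic laws -/

theorem frob_single (A : Mat) (i j : Fin 3) : frob A (Matrix.single i j 1) = A i j := by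
  rw [frob_eq_sum, Finset.sum_eq_single i, Finset.sum_eq_single j]
  · simp
  · intro q _ hq
    simp [hq.symm]
  · simp
  · intro p _ hp
    simp [hp.symm]
  · simp

theorem frob_transpose_mul_mul (P R A K : Mat) :
    frob A (Pᵀ * K * Rᵀ) = frob (P * A * R) K := by
  have h : A * (Pᵀ * K * Rᵀ)ᵀ = A * R * Kᵀ * P := by
    simp only [Matrix.transpose_mul, Matrix.transpose_transpose, Matrix.mul_assoc]
  rw [frob, h, Matrix.trace_mul_comm, frob]
  simp only [Matrix.mul_assoc]

theorem fderiv_eq_frob (W : Mat → ℝ) (F H : Mat) :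
    fderiv ℝ W F H = frob (firstPiola W F) H := by
  conv_lhs => rw [Matrix.matrix_eq_sum_single H]
  rw [frob_eq_sum, map_sum]
  refine Finset.sum_congr rfl fun i _ => ?_
  rw [map_sum]
  refine Finset.sum_congr rfl fun j _ => ?_
  have : Matrix.single i j (H i j) = H i j • (Matrix.single i j 1 : Mat) := by
    rw [Matrix.smul_single, smul_eq_mul, mul_one]
  rw [this, map_smul, smul_eq_mul, mul_comm, firstPiola, Matrix.of_apply]

namespace IsIsotropicEnergy

theorem apply_mul_mul {W : Mat → ℝ} (h : IsIsotropicEnergy W) {P R : Mat} (hP : P ∈ SO3)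
    (hR : R ∈ SO3) {F : Mat} (hF : F ∈ GLpos) : W (P * F * R) = W F := by
  have hPt : Pᵀ ∈ SO3 :=
    ⟨by rw [Matrix.transpose_transpose, mul_transpose_of_transpose_mul hP.1], by
      rw [Matrix.det_transpose, hP.2]⟩
  have := h.invariant F hF Pᵀ hPt R hR
  rwa [Matrix.transpose_transpose] at this

theorem differentiableAt {W : Mat → ℝ} (h : IsIsotropicEnergy W) {F : Mat} (hF : F ∈ GLpos) :
    DifferentiableAt ℝ W F :=
  h.differentiable.differentiableAt (isOpen_GLpos.mem_nhds hF)

theorem fderiv_mul_mul {W : Mat → ℝ} (h : IsIsotropicEnergy W) {P R : Mat} (hP : P ∈ SO3)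
    (hR : R ∈ SO3) {F : Mat} (hF : F ∈ GLpos) (H : Mat) :
    fderiv ℝ W (P * F * R) (P * H * R) = fderiv ℝ W F H := by
  have hF0 : F + (0 : ℝ) • H = F := by simp
  have hmem := mul_mem_GLpos (mul_mem_GLpos (mem_GLpos_of_mem_SO3 hP) hF) (mem_GLpos_of_mem_SO3 hR)
  have h1 := hasDerivAt_comp_curve_real (f := W) (by rw [hF0]; exact h.differentiableAt hF)
    (hasDerivAt_line F H)
  have h2 := hasDerivAt_comp_curve_real (f := W) (by rw [hF0]; exact h.differentiableAt hmem)
    (hasDerivAt_mul_mul P R (hasDerivAt_line F H))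
  rw [hF0] at h1 h2
  refine h2.unique (h1.congr_of_eventuallyEq ?_)
  have hmemS : ∀ᶠ s in nhds (0 : ℝ), F + s • H ∈ GLpos :=
    (by fun_prop : Continuous fun s : ℝ => F + s • H).continuousAt.eventually_mem
      (by simpa only [hF0] using isOpen_GLpos.mem_nhds hF)
  filter_upwards [hmemS] with s hs using h.apply_mul_mul hP hR hs

theorem fderiv_skew_mul {W : Mat → ℝ} (h : IsIsotropicEnergy W) {Ω : Mat} (hΩ : Ωᵀ = -Ω)
    {F : Mat} (hF : F ∈ GLpos) : fderiv ℝ W F (Ω * F) = 0 := by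
  have hc := hasDerivAt_mul_mul 1 F (hasDerivAt_exp_smul Ω)
  simp only [Matrix.one_mul] at hc
  have hF0 : NormedSpace.exp ((0 : ℝ) • Ω) * F = F := by simp
  have h1 := hasDerivAt_comp_curve_real (f := W) (by rw [hF0]; exact h.differentiableAt hF) hc
  have hconst : (fun s : ℝ => W (NormedSpace.exp (s • Ω) * F)) = fun _ => W F := funext fun s => by
    have hs : (s • Ω)ᵀ = -(s • Ω) := by rw [Matrix.transpose_smul, hΩ, smul_neg]
    have := h.apply_mul_mul (exp_mem_SO3 hs) (⟨by simp, by simp⟩ : (1 : Mat) ∈ SO3) hF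
    rwa [Matrix.mul_one] at this
  rw [hF0, hconst] at h1
  exact h1.unique (hasDerivAt_const _ _)

theorem firstPiola_mul_mul {W : Mat → ℝ} (h : IsIsotropicEnergy W) {P R : Mat} (hP : P ∈ SO3)
    (hR : R ∈ SO3) {F : Mat} (hF : F ∈ GLpos) :
    firstPiola W (P * F * R) = P * firstPiola W F * R := by
  have key : ∀ K : Mat, frob (firstPiola W (P * F * R)) K = frob (P * firstPiola W F * R) K := by
    intro K
    have hK : P * (Pᵀ * K * Rᵀ) * R = K := by
      calc P * (Pᵀ * K * Rᵀ) * R = (P * Pᵀ) * K * (Rᵀ * R) := by simp only [Matrix.mul_assoc]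
        _ = K := by
          rw [mul_transpose_of_transpose_mul hP.1, hR.1, Matrix.one_mul, Matrix.mul_one]
    have h1 := h.fderiv_mul_mul hP hR hF (Pᵀ * K * Rᵀ)
    rw [hK, fderiv_eq_frob, fderiv_eq_frob] at h1
    rw [h1, frob_transpose_mul_mul]
  ext i j
  have hij := key (Matrix.single i j 1)
  rwa [frob_single, frob_single] at hij

/-- Invariance of W under superposed rotations makes its derivative vanish on ΩF, so the stress is
orthogonal to all skew matrices. -/
theorem isSymm_firstPiola_mul {W : Mat → ℝ} (h : IsIsotropicEnergy W) {F : Mat}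
    (hF : F ∈ GLpos) : (firstPiola W F * Fᵀ).IsSymm := by
  have key : ∀ Ω : Mat, Ωᵀ = -Ω → frob (firstPiola W F * Fᵀ) Ω = 0 := fun Ω hΩ => by
    have := h.fderiv_skew_mul hΩ hF
    rwa [fderiv_eq_frob, frob, Matrix.transpose_mul, ← Matrix.mul_assoc] at this
  ext i j
  have hij := key (Matrix.single i j 1 - Matrix.single j i 1) (by
    rw [Matrix.transpose_sub, Matrix.transpose_single, Matrix.transpose_single, neg_sub])
  have hsub : ∀ A B C : Mat, frob A (B - C) = frob A B - frob A C := fun A B C => by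
    simp only [frob, Matrix.transpose_sub, Matrix.mul_sub, Matrix.trace_sub]
  rw [hsub, frob_single, frob_single] at hij
  rw [Matrix.transpose_apply]
  linarith

theorem isIsotropicCauchyElastic {W : Mat → ℝ} (h : IsIsotropicEnergy W) :
    IsIsotropicCauchyElastic (cauchyStress W) where
  symm F hF := (h.isSymm_firstPiola_mul hF).smul _
  objective F hF Q hQ := by
    have := h.firstPiola_mul_mul hQ (⟨by simp, by simp⟩ : (1 : Mat) ∈ SO3) hF
    rw [Matrix.mul_one, Matrix.mul_one] at this
    rw [cauchyStress, cauchyStress, this, Matrix.det_mul, hQ.2, one_mul, Matrix.transpose_mul,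
      Matrix.mul_smul, Matrix.smul_mul]
    simp only [Matrix.mul_assoc]
  isotropic F hF Q hQ := by
    have := h.firstPiola_mul_mul (⟨by simp, by simp⟩ : (1 : Mat) ∈ SO3) hQ hF
    rw [Matrix.one_mul, Matrix.one_mul] at this
    have hcancel : firstPiola W F * Q * (F * Q)ᵀ = firstPiola W F * Fᵀ := by
      calc firstPiola W F * Q * (F * Q)ᵀ = firstPiola W F * (Q * Qᵀ) * Fᵀ := by
            simp only [Matrix.transpose_mul, Matrix.mul_assoc]
        _ = firstPiola W F * Fᵀ := by
            rw [mul_transpose_of_transpose_mul hQ.1, Matrix.mul_one]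
    rw [cauchyStress, cauchyStress, this, Matrix.det_mul, hQ.2, mul_one, hcancel]
  differentiable :=
    differentiableOn_smul
      (differentiableOn_inv differentiable_det.differentiableOn fun _ hF => ne_of_gt hF)
      (differentiableOn_mul_transpose h.differentiable_gradient)

end IsIsotropicEnergy

theorem kirchhoff_cauchyStress (W : Mat → ℝ) {F : Mat} (hF : F ∈ GLpos) :
    kirchhoff (cauchyStress W) F = firstPiola W F * Fᵀ := by
  rw [kirchhoff, cauchyStress, smul_smul, mul_inv_cancel₀ (ne_of_gt hF), one_smul]

/-- The stress power is `⟨τ, D⟩`, and also `⟨τ, H⟩` for the rate `H` of the logarithmic strain. -/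
theorem frob_mul_exp_neg_fderiv_exp {τ : Mat → Mat} (h : IsIsotropicCauchyElastic τ) {X : Mat}
    (hX : X.IsSymm) (H : Mat) :
    frob (τ (NormedSpace.exp X) * NormedSpace.exp (-X))
      (fderiv ℝ (NormedSpace.exp : Mat → Mat) X H) = frob (τ (NormedSpace.exp X)) H := by
  obtain ⟨Q, x, hQ, rfl⟩ := exists_orthogonal_diagonal hX
  obtain ⟨K, rfl⟩ : ∃ K, H = Q * K * Qᵀ := ⟨Qᵀ * H * Q, by
    calc H = (Q * Qᵀ) * H * (Q * Qᵀ) := by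
          rw [mul_transpose_of_transpose_mul hQ, Matrix.one_mul, Matrix.mul_one]
      _ = Q * (Qᵀ * H * Q) * Qᵀ := by simp only [Matrix.mul_assoc]⟩
  set V : Mat := NormedSpace.exp (Matrix.diagonal x : Mat) with hV
  have hVG : V ∈ GLpos := exp_mem_GLpos _
  have hneg : -(Q * Matrix.diagonal x * Qᵀ) = Q * Matrix.diagonal (-x) * Qᵀ := by
    rw [← Matrix.neg_mul, ← Matrix.mul_neg, Matrix.diagonal_neg]
    rfl
  have hprod : Q * τ V * Qᵀ * (Q * NormedSpace.exp (Matrix.diagonal (-x)) * Qᵀ) =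
      Q * (τ V * NormedSpace.exp (Matrix.diagonal (-x))) * Qᵀ := by
    calc _ = Q * τ V * (Qᵀ * Q) * NormedSpace.exp (Matrix.diagonal (-x)) * Qᵀ := by
          simp only [Matrix.mul_assoc]
      _ = _ := by rw [hQ, Matrix.mul_one]; simp only [Matrix.mul_assoc]
  rw [hneg, exp_conj_orthogonal hQ, exp_conj_orthogonal hQ, ← hV, h.apply_conj hQ hVG, hprod,
    fderiv_exp_conj hQ, frob_conj hQ, frob_conj hQ]
  -- The stress is coaxial with V. Hence only diagonal entries of the derivative of exp contribute,
  -- and there the factor e^{x_i} cancels against the inverse of V.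
  have hτ : τ V = Matrix.diagonal (τ V).diag := eq_diagonal_of_reflection fun k => by
    have := h.apply_conj (reflection_orthogonal k) hVG
    rw [hV, ← exp_conj_orthogonal (reflection_orthogonal k), reflection_mul_diagonal] at this
    exact this.symm
  rw [hτ, exp_diagonal_real, fderiv_exp_diagonal, Matrix.diagonal_mul_diagonal, frob_eq_sum,
    frob_eq_sum]
  refine Finset.sum_congr rfl fun i _ => Finset.sum_congr rfl fun j _ => ?_
  rcases eq_or_ne i j with rfl | hij
  · rw [Matrix.diagonal_apply_eq, Matrix.diagonal_apply_eq, Matrix.hadamard_apply, Matrix.of_apply,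
      expDiff_self, Pi.neg_apply, Real.exp_neg]
    field_simp
  · rw [Matrix.diagonal_apply_ne _ hij, Matrix.diagonal_apply_ne _ hij, zero_mul, zero_mul]

/-- Identifies τ̂ as the gradient of X ↦ W(exp X): at a symmetric V the first Piola stress is τV⁻¹,
so the stress-power identity applies. -/
theorem fderiv_energy_exp {W : Mat → ℝ} (h : IsIsotropicEnergy W) (X H : Sym3) :
    fderiv ℝ W (NormedSpace.exp (X : Mat)) (fderiv ℝ (NormedSpace.exp : Mat → Mat) X H) =
      frob (hatTau (cauchyStress W) X) H := by
  have hτ := isIsotropicCauchyElastic_kirchhoff h.isIsotropicCauchyElastic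
  have hsymm : (NormedSpace.exp (X : Mat))ᵀ = NormedSpace.exp (X : Mat) :=
    Matrix.IsSymm.exp X.2
  rw [hatTau, ← frob_mul_exp_neg_fderiv_exp hτ X.2, fderiv_eq_frob,
    kirchhoff_cauchyStress W (exp_mem_GLpos _), hsymm, Matrix.mul_assoc, exp_mul_exp_neg,
    Matrix.mul_one]

/-- The derivative of a field that represents a gradient is symmetric. -/
theorem apply_fderiv_comm_of_gradient {E M : Type*} [NormedAddCommGroup E] [NormedSpace ℝ E]
    [FiniteDimensional ℝ E] [NormedAddCommGroup M] [NormedSpace ℝ M] [FiniteDimensional ℝ M]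
    (B : M →ₗ[ℝ] E →ₗ[ℝ] ℝ) {f : E → ℝ} {g : E → M}
    (hf : ∀ y, HasFDerivAt f (LinearMap.toContinuousLinearMap (B (g y))) y) {x : E}
    (hg : DifferentiableAt ℝ g x) (v w : E) : B (fderiv ℝ g x v) w = B (fderiv ℝ g x w) v := by
  -- Through Φ the field g becomes the derivative of f. Symmetry of the second derivative then needs
  -- only differentiability of this derivative at x, so no continuity of the tangent enters.
  let Φ : M →L[ℝ] (E →L[ℝ] ℝ) := LinearMap.toContinuousLinearMap
    ((LinearMap.toContinuousLinearMap : (E →ₗ[ℝ] ℝ) ≃ₗ[ℝ] (E →L[ℝ] ℝ)).toLinearMap ∘ₗ B)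
  have h : HasFDerivAt (fun y => Φ (g y)) (Φ.comp (fderiv ℝ g x)) x :=
    Φ.hasFDerivAt.comp x hg.hasFDerivAt
  exact second_derivative_symmetric hf h v w

theorem tangent_cauchyStress_comm {W : Mat → ℝ} (h : IsIsotropicEnergy W) (X H K : Sym3) :
    tangent (cauchyStress W) X H K = tangent (cauchyStress W) X K H := by
  have hW := fun Y : Sym3 => h.differentiableAt (exp_mem_GLpos (Y : Mat))
  have hexp := fun Y : Sym3 => differentiable_exp (Y : Mat)
  have hval := fderiv_energy_exp h
  have hd := differentiable_hatTau h.isIsotropicCauchyElastic X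
  let : NormedRing Mat := Matrix.linftyOpNormedRing
  let : NormedAlgebra ℝ Mat := Matrix.linftyOpNormedAlgebra
  let B : Mat →ₗ[ℝ] Sym3 →ₗ[ℝ] ℝ := LinearMap.mk₂ ℝ (fun A Y => frob A (Y : Mat))
    (fun _ _ _ => by simp [frob, Matrix.add_mul]) (fun _ _ _ => by simp [frob])
    (fun _ _ _ => by simp [frob, Matrix.mul_add]) (fun _ _ _ => by simp [frob])
  have h1 : ∀ Y : Sym3, HasFDerivAt (fun Y : Sym3 => W (NormedSpace.exp (Y : Mat)))
      (LinearMap.toContinuousLinearMap (B (hatTau (cauchyStress W) Y))) Y := fun Y => by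
    have hincl : HasFDerivAt (fun Y : Sym3 => (Y : Mat)) Sym3.subtypeL Y :=
      Sym3.subtypeL.hasFDerivAt
    have hc := ((DifferentiableAt.hasFDerivAt (hW Y)).comp (Y : Mat)
      (DifferentiableAt.hasFDerivAt (hexp Y))).comp Y hincl
    refine HasFDerivAt.congr_fderiv hc ?_
    ext Z
    exact hval Y Z
  exact apply_fderiv_comm_of_gradient B h1 hd H K

theorem symPart_tangent_cauchyStress {W : Mat → ℝ} (h : IsIsotropicEnergy W) (X : Sym3) :
    symPart (tangent (cauchyStress W) X) = tangent (cauchyStress W) X := by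
  refine LinearMap.ext₂ fun H K => ?_
  change 1 / 2 * (tangent (cauchyStress W) X H K + tangent (cauchyStress W) X K H) = _
  rw [tangent_cauchyStress_comm h X K H]
  ring

end Hyperelastic

end HillInequality

theorem mainTheorem3 :
    (∀ σ : Mat → Mat, IsIsotropicCauchyElastic σ →
      Differentiable ℝ (hatTau σ) ∧
      (∀ F ∈ GLpos, kirchhoff σ F = hatTau σ (logSym (leftStretch F))) ∧
      (∀ F ∈ GLpos,
        (CorotationalAt (kirchhoff σ) F ↔
          IsSymPosDef4 (symPart (tangent σ (logSym (leftStretch F)))))) ∧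
      ((∀ F ∈ GLpos, CorotationalAt (kirchhoff σ) F) ↔
        ∀ V : Mat, V.PosDef → IsSymPosDef4 (symPart (tangent σ (logSym V)))) ∧
      ((∀ V : Mat, V.PosDef → IsSymPosDef4 (symPart (tangent σ (logSym V)))) →
        StrictlyMonotoneInLog σ)) ∧
    (∀ W : Mat → ℝ, IsIsotropicEnergy W →
      IsIsotropicCauchyElastic (cauchyStress W) ∧
      (∀ F ∈ GLpos, kirchhoff (cauchyStress W) F =
        hatTau (cauchyStress W) (logSym (leftStretch F))) ∧
      (∀ X : Sym3, symPart (tangent (cauchyStress W) X) = tangent (cauchyStress W) X) ∧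
      (∀ F ∈ GLpos,
        (CorotationalAt (kirchhoff (cauchyStress W)) F ↔
          IsSymPosDef4 (tangent (cauchyStress W) (logSym (leftStretch F))))) ∧
      ((∀ F ∈ GLpos, CorotationalAt (kirchhoff (cauchyStress W)) F) ↔
        ∀ V : Mat, V.PosDef → IsSymPosDef4 (tangent (cauchyStress W) (logSym V))) ∧
      ((∀ V : Mat, V.PosDef → IsSymPosDef4 (tangent (cauchyStress W) (logSym V))) →
        StrictlyMonotoneInLog (cauchyStress W))) := by
  refine ⟨fun σ h => ⟨differentiable_hatTau h, fun F hF => kirchhoff_eq_hatTau h hF,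
    fun F hF => corotationalAt_iff_isSymPosDef4 h hF, forall_corotationalAt_iff h,
    strictlyMonotoneInLog_of_isSymPosDef4 h⟩, fun W hW => ?_⟩
  have h := hW.isIsotropicCauchyElastic
  have hsym := symPart_tangent_cauchyStress hW
  refine ⟨h, fun F hF => kirchhoff_eq_hatTau h hF, hsym, fun F hF => ?_, ?_, fun hpos => ?_⟩
  · rw [corotationalAt_iff_isSymPosDef4 h hF, hsym]
  · rw [forall_corotationalAt_iff h]
    simp only [hsym]
  · exact strictlyMonotoneInLog_of_isSymPosDef4 h (by simpa only [hsym] using hpos)
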